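/- **Definitions.** An *extended $\omega$-Petri net* is a triple $\mathcal N=\langle P,T,m_0\rangle$ where $P$ is a finite set of places, $m_0:P\to\mathbb N$ is the initial marking, and $T$ is a finite set of transitions. Each transition is a pair $t=(I,O)$ with $I:P\to\mathbb N\cup\{\omega,\mathsf T,\mathsf R\}$ and $O:P\to\mathbb N\cup\{\omega,\mathsf T\}$ such that: at most one place $p$ has $I(p)\in\{\mathsf T,\mathsf R\}$; at most one place $q$ has $O(q)=\mathsf T$; some $p$ has $I(p)=\mathsf T$ if and only if some $q$ has $O(q)=\mathsf T$; and if some $p$ has $I(p)=\mathsf R$, then $O(q)\in\mathbb N\cup\{\omega\}$ for all $q$. A transition $t=(I,O)$ is enabled in a marking $m:P\to\mathbb N$ iff $m(p)\ge I(p)$ for all $p$ with $I(p)\in\mathbb N$. Firing it then yields any marking $m'=m-m_I+m_O$ (written $m\xrightarrow{t}m'$), where for each place $p$: $m_I(p)=I(p)$ if $I(p)\in\mathbb N$; $m_I(p)$ is an arbitrary element of $\{0,\dots,m(p)\}$ if $I(p)=\omega$; $m_I(p)=m(p)$ if $I(p)\in\{\mathsf T,\mathsf R\}$; and $m_O(p)=O(p)$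 if $O(p)\in\mathbb N$; $m_O(p)$ is an arbitrary natural number if $O(p)=\omega$; $m_O(p)=m(p')$ if $O(p)=\mathsf T$, where $p'$ is the place with $I(p')=\mathsf T$. The net $\mathcal N$ *terminates* if it has no infinite execution $m_0\xrightarrow{t_1}m_1\xrightarrow{t_2}m_2\cdots$ with all $t_i\in T$. An *$\omega$-output Petri net with transfer arcs* ($\omega$OPN+T) is an extended $\omega$-Petri net in which no transition has an input label in $\{\omega,\mathsf R\}$; an *$\omega$-output Petri net with reset arcs* ($\omega$OPN+R) is one in which no transition has an input label in $\{\omega,\mathsf T\}$. An *$\omega$-output arc* is a pair $(t,p)$ with $t=(I,O)\in T$, $p\in P$ and $O(p)=\omega$. **Theorem.** The termination problem (given the net, does it terminate?) is undecidable for $\omega$OPN+T, and it is undecidable for $\omega$OPN+R. Each of the two problems remains undecidable when its instances are restricted to the nets with exactly one $\omega$-output arc. -/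

import Mathlib

namespace OmegaNet

/-- Labels of input arcs: a number of tokens, `ω`, a transfer `T`, or a reset `R`. -/
inductive InLabel : Type
  | num (n : ℕ)
  | omega
  | transfer
  | reset

/-- Labels of output arcs: a number of tokens, `ω`, or a transfer `T`. -/
inductive OutLabel : Type
  | num (n : ℕ)
  | omega
  | transfer

/-- A marking of the places `0, …, k - 1`. -/
abbrev Marking (k : ℕ) : Type := Fin k → ℕ

/-- A transition `(I, O)` of an extended ω-Petri net with `k` places. -/
@[ext]
structure Transition (k : ℕ) where
  /-- The input effect `I`. -/
  input : Fin k → InLabel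
  /-- The output effect `O`. -/
  output : Fin k → OutLabel
  /-- At most one place `p` has `I(p) ∈ {T, R}`. -/
  input_special : {p | input p = .transfer ∨ input p = .reset}.Subsingleton
  /-- At most one place `q` has `O(q) = T`. -/
  output_special : {q | output q = .transfer}.Subsingleton
  /-- There is an input transfer arc iff there is an output transfer arc. -/
  transfer_iff : (∃ p, input p = .transfer) ↔ ∃ q, output q = .transfer
  /-- If there is a reset arc, all outputs are numbers or `ω`. -/
  reset_output : (∃ p, input p = .reset) → ∀ q, output q ≠ .transfer

/-- `Consumes a x c`: from a place holding `x` tokens, an input arc labelled `a` may remove exactly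
`c` tokens. In every case `c ≤ x`. -/
def Consumes : InLabel → ℕ → ℕ → Prop
  | .num n, x, c => n ≤ x ∧ c = n
  | .omega, x, c => c ≤ x
  | .transfer, x, c => c = x
  | .reset, x, c => c = x

/-- `Produces t m b c`: when `t` is fired in the marking `m`, an output arc of `t` labelled `b` may
add exactly `c` tokens. A transfer adds what the input transfer place of `t` holds in `m`. -/
def Produces {k : ℕ} (t : Transition k) (m : Marking k) : OutLabel → ℕ → Prop
  | .num n, c => c = n
  | .omega, _ => True
  | .transfer, c => ∃ p, t.input p = .transfer ∧ c = m p

/-- The (concrete) firing relation `m —t→ m'`, that is `m' = m - m_I + m_O`. -/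
def Fires {k : ℕ} (t : Transition k) (m m' : Marking k) : Prop :=
  ∃ mI mO : Marking k,
    (∀ p, Consumes (t.input p) (m p) (mI p)) ∧
    (∀ p, Produces t m (t.output p) (mO p)) ∧
    ∀ p, m' p = m p - mI p + mO p

/-- An initialised extended ω-Petri net `(P, T, m₀)`: the places are `0, …, places - 1`, and the
finite set `T` is given by an enumeration without repetitions. -/
structure Net where
  /-- The number of places. -/
  places : ℕ
  /-- The transitions. -/
  transitions : List (Transition places)
  nodup : transitions.Nodup
  /-- The initial marking. -/
  init : Marking places

/-- `m 0, t 0, m 1, t 1, …` is an infinite execution of `N`. -/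
def Net.IsInfiniteExecution (N : Net) (m : ℕ → Marking N.places)
    (t : ℕ → Transition N.places) : Prop :=
  m 0 = N.init ∧ ∀ i, t i ∈ N.transitions ∧ Fires (t i) (m i) (m (i + 1))

/-- `N` terminates: all its executions are finite. -/
def Net.Terminates (N : Net) : Prop :=
  ¬ ∃ m t, N.IsInfiniteExecution m t

/-- ωPN+T: no transition is a reset. -/
def Net.IsOmegaPNT (N : Net) : Prop :=
  ∀ t ∈ N.transitions, ∀ p, t.input p ≠ .reset

/-- ωPN+R: no transition is a transfer. -/
def Net.IsOmegaPNR (N : Net) : Prop :=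
  ∀ t ∈ N.transitions, ∀ p, t.input p ≠ .transfer

/-- No input arc is labelled by `ω`. -/
def Net.NoOmegaInput (N : Net) : Prop :=
  ∀ t ∈ N.transitions, ∀ p, t.input p ≠ .omega

/-- ω-output Petri nets with transfer arcs. -/
def Net.IsOmegaOPNT (N : Net) : Prop := N.IsOmegaPNT ∧ N.NoOmegaInput

/-- ω-output Petri nets with reset arcs. -/
def Net.IsOmegaOPNR (N : Net) : Prop := N.IsOmegaPNR ∧ N.NoOmegaInput

/-- The set of output arcs labelled by `ω`. -/
def Net.omegaOutputArcs (N : Net) : Set (Transition N.places × Fin N.places) :=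
  {a | a.1 ∈ N.transitions ∧ a.1.output a.2 = .omega}

/-- There is exactly one output arc labelled by `ω`. -/
def Net.HasOneOmegaOutputArc (N : Net) : Prop := N.omegaOutputArcs.ncard = 1

/-- Codes of input labels. -/
def InLabel.code : InLabel → ℕ
  | .omega => 0
  | .transfer => 1
  | .reset => 2
  | .num n => n + 3

/-- Codes of output labels. -/
def OutLabel.code : OutLabel → ℕ
  | .omega => 0
  | .transfer => 1
  | .num n => n + 3

/-- The finite object that presents a net to an algorithm: the number of places, the list of the
transitions (each as the two lists of its labels), and the list of the values of the initial
marking. -/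
abbrev NetCode : Type := ℕ × List (List ℕ × List ℕ) × List ℕ

/-- The code of a transition. -/
def Transition.code {k : ℕ} (t : Transition k) : List ℕ × List ℕ :=
  (List.ofFn fun p => (t.input p).code, List.ofFn fun p => (t.output p).code)

/-- The code of a net. -/
def Net.code (N : Net) : NetCode :=
  (N.places, N.transitions.map Transition.code, List.ofFn N.init)

theorem InLabel.code_injective : Function.Injective InLabel.code := by
  intro a b h
  cases a <;> cases b <;> simp_all [InLabel.code]

theorem OutLabel.code_injective : Function.Injective OutLabel.code := by
  intro a b h
  cases a <;> cases b <;> simp_all [OutLabel.code]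

theorem Transition.code_injective {k : ℕ} :
    Function.Injective (Transition.code : Transition k → List ℕ × List ℕ) := by
  intro s t h
  have h1 := List.ofFn_injective (congrArg Prod.fst h)
  have h2 := List.ofFn_injective (congrArg Prod.snd h)
  ext p
  · exact InLabel.code_injective (congrFun h1 p)
  · exact OutLabel.code_injective (congrFun h2 p)

/-- Distinct nets have distinct codes. -/
theorem Net.code_injective : Function.Injective Net.code := by
  rintro ⟨k, T, hT, m⟩ ⟨k', T', hT', m'⟩ h
  simp only [Net.code, Prod.mk.injEq] at h
  obtain ⟨rfl, h1, h2⟩ := h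
  obtain rfl := Transition.code_injective.list_map h1
  obtain rfl := List.ofFn_injective h2
  rfl

/-- The termination problem is decidable for the nets in the class `C`: there is an algorithm (a
partial recursive function on codes) that, on the code of any net in `C`, halts and answers
correctly whether the net terminates. On other inputs it may do anything. -/
def TerminationDecidableOn (C : Net → Prop) : Prop :=
  ∃ f : NetCode →. Bool, Partrec f ∧ ∀ N, C N →
    (true ∈ f N.code ↔ N.Terminates) ∧ (false ∈ f N.code ↔ ¬ N.Terminates)

end OmegaNet

/-! The halting problem is reduced to non-termination. Primitive recursion and one unbounded search
give a universal loop program, hence a counter machine `M` that halts on `n` iff the `n`-th partial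
recursive code halts on `0`. A final block makes `M` exit with all counters empty
(`exists_counterExec_iff_dom`).

Resets and transfers cannot test for zero, but they can empty a counter. So `M` is simulated with a
zero test that always succeeds and clears the counter. Each simulated step is paid from a budget,
and the payment is kept in `used` or in a counter. No step increases the total of budget, used
tokens and counters, and a wrong zero test decreases it. After an exit, used tokens may be refunded,
and `M` may be restarted on `n` further tokens taken from the budget.

In an infinite run the total is eventually constant, so from then on every zero test is correct. A
rank decreases between restarts, so restarts recur. A late run of `M` between two restarts leaves
the counters empty, so the next one starts on exactly `n` and exits
(`exists_counterExec_of_infinite`). Conversely, if `M` halts on `n`, a large enough budget gives a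
cycle (`exists_cycle`). The necessary budget is not known in advance; the single ω-output arc
guesses it.

One construction serves both classes: a reset is replaced by a transfer to an extra place from which
nothing is consumed. Only the restart transition depends on `n`, so the code of the net is
computable from `n`. -/

/-! ### Loop programs compute the primitive recursive functions. -/

/-- Loop programs over registers indexed by `ℕ`. `loop r P` decrements `r` and runs `P` as long as
`r` is positive. -/
inductive LoopProg : Type
  | inc (r : ℕ)
  | dec (r : ℕ)
  | seq (P Q : LoopProg)
  | loop (r : ℕ) (P : LoopProg)

namespace LoopProg

open Function

/-- `Eval P v w`: started on the register contents `v`, the program `P` halts with contents `w`. -/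
inductive Eval : LoopProg → (ℕ → ℕ) → (ℕ → ℕ) → Prop
  | inc (r : ℕ) (v : ℕ → ℕ) : Eval (inc r) v (update v r (v r + 1))
  | dec (r : ℕ) (v : ℕ → ℕ) : Eval (dec r) v (update v r (v r - 1))
  | seq {P Q : LoopProg} {u v w : ℕ → ℕ} : Eval P u v → Eval Q v w → Eval (seq P Q) u w
  | loop_zero {r : ℕ} {P : LoopProg} {v : ℕ → ℕ} : v r = 0 → Eval (loop r P) v v
  | loop_pos {r : ℕ} {P : LoopProg} {u v w : ℕ → ℕ} : u r ≠ 0 →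
      Eval P (update u r (u r - 1)) v → Eval (loop r P) v w → Eval (loop r P) u w

theorem Eval.det {P : LoopProg} {u v w : ℕ → ℕ} (h : Eval P u v) (h' : Eval P u w) : v = w := by
  induction h generalizing w with
  | inc r v => cases h'; rfl
  | dec r v => cases h'; rfl
  | seq _ _ ih₁ ih₂ =>
    cases h' with
    | seq a b => obtain rfl := ih₁ a; exact ih₂ b
  | loop_zero h0 =>
    cases h' with
    | loop_zero _ => rfl
    | loop_pos h1 _ _ => exact absurd h0 h1
  | loop_pos h0 _ _ ih₁ ih₂ =>
    cases h' with
    | loop_zero h1 => exact absurd h1 h0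
    | loop_pos _ a b => obtain rfl := ih₁ a; exact ih₂ b

theorem Eval.congr {P : LoopProg} {u v w : ℕ → ℕ} (h : Eval P u v) (e : v = w) : Eval P u w :=
  e ▸ h

/-- A loop that runs through the contents `s N, …, s 0`, where `s n` holds `n` in the loop
register. -/
theorem Eval.loop_of_forall {r : ℕ} {P : LoopProg} (s : ℕ → ℕ → ℕ) (N : ℕ)
    (hr : ∀ n ≤ N, s n r = n)
    (hs : ∀ n < N, Eval P (update (s (n + 1)) r n) (s n)) : Eval (loop r P) (s N) (s 0) := by
  induction N with
  | zero => exact .loop_zero (hr 0 le_rfl)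
  | succ N ih =>
    refine .loop_pos (v := s N) ?_ ?_ (ih (fun n hn => hr n (by lia)) fun n hn => hs n (by lia))
    · rw [hr _ le_rfl]; lia
    · rw [hr _ le_rfl]; exact hs N (by lia)

/-- The program that does nothing. -/
def skip : LoopProg := seq (inc 0) (dec 0)

theorem eval_skip (v : ℕ → ℕ) : Eval skip v v :=
  (Eval.seq (.inc _ _) (.dec _ _)).congr (by simp)

/-- Sets the register `r` to `0`. -/
def clear (r : ℕ) : LoopProg := loop r skip

theorem eval_clear (r : ℕ) (v : ℕ → ℕ) : Eval (clear r) v (update v r 0) := by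
  have := Eval.loop_of_forall (P := skip) (r := r) (fun n => update v r n) (v r) (by simp)
    (fun n _ => (eval_skip _).congr (by simp))
  simpa [clear] using this

/-- Clears the registers `k, …, k + n - 1`. -/
def clearRange (k : ℕ) : ℕ → LoopProg
  | 0 => skip
  | n + 1 => seq (clearRange k n) (clear (k + n))

theorem eval_clearRange (k n : ℕ) (v : ℕ → ℕ) :
    Eval (clearRange k n) v (fun r => if k ≤ r ∧ r < k + n then 0 else v r) := by
  induction n with
  | zero => exact (eval_skip v).congr (by ext r; rw [if_neg (by lia)])
  | succ n ih =>
    refine (Eval.seq ih (eval_clear _ _)).congr ?_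
    ext r
    simp only [update_apply]
    split_ifs <;> first | rfl | lia

/-- Copies the register `a` to the register `b`, using the register `t` as scratch space. -/
def copy (a b t : ℕ) : LoopProg :=
  seq (clear b) (seq (loop a (seq (inc b) (inc t))) (loop t (inc a)))

theorem eval_copy {a b t : ℕ} (hab : a ≠ b) (hat : a ≠ t) (hbt : b ≠ t) {v : ℕ → ℕ}
    (ht : v t = 0) : Eval (copy a b t) v (update v b (v a)) := by
  -- The first loop drains `a` into both `b` and `t`; the second pours `t` back into `a`.
  refine .seq (eval_clear _ _) (.seq (v := update (update (update v a 0) b (v a)) t (v a)) ?_ ?_)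
  · have := Eval.loop_of_forall (P := seq (inc b) (inc t)) (r := a)
      (fun n => update (update (update v a n) b (v a - n)) t (v a - n)) (v a)
      (by intro n _; simp [hab, hat])
      (fun n hn => (Eval.seq (.inc _ _) (.inc _ _)).congr (by
        ext r; simp only [update_apply]; split_ifs <;> first | rfl | lia))
    convert this using 1 <;> ext r <;> simp only [update_apply] <;> split_ifs <;>
      first | rfl | lia
  · have := Eval.loop_of_forall (P := inc a) (r := t)
      (fun n => update (update (update v a (v a - n)) b (v a)) t n) (v a)
      (by intro n _; simp)
      (fun n hn => (Eval.inc _ _).congr (by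
        ext r; simp only [update_apply]; split_ifs <;> first | rfl | lia))
    convert this using 1 <;> ext r <;> simp only [update_apply] <;> split_ifs <;>
      first | rfl | lia

/-- `f` is computed by programs that read their arguments in given registers below `k`, write the
result to a given register below `k`, and use as scratch space the registers from `k` on. -/
def Computable {n : ℕ} (f : List.Vector ℕ n → ℕ) : Prop :=
  ∀ (k : ℕ) (a : Fin n → ℕ) (b : ℕ), (∀ i, a i < k) → b < k → (∀ i, a i ≠ b) →
    ∃ P, ∀ v : ℕ → ℕ, (∀ r, k ≤ r → v r = 0) →
      Eval P v (update v b (f (List.Vector.ofFn fun i => v (a i))))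

/-- The values of the `g i` are stored in the registers `k, …, k + n - 1`, each computed with
scratch space from `k + n` on. Then `f` reads them, and they are cleared. -/
theorem Computable.comp {m n : ℕ} {f : List.Vector ℕ n → ℕ} {g : Fin n → List.Vector ℕ m → ℕ}
    (hf : Computable f) (hg : ∀ i, Computable (g i)) :
    Computable fun a => f (List.Vector.ofFn fun i => g i a) := by
  intro k a b ha hb hab
  -- The contents once `j` of the values are stored. For `j ≤ n` the bound `r < k + n` is redundant;
  -- it makes `r - k` an index below `n`.
  let s : ℕ → (ℕ → ℕ) → ℕ → ℕ := fun j v r =>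
    if h : k ≤ r ∧ r < k + j ∧ r < k + n then
      g ⟨r - k, by lia⟩ (List.Vector.ofFn fun i => v (a i)) else v r
  have args : ∀ j ≤ n, ∃ P, ∀ v : ℕ → ℕ, (∀ r, k ≤ r → v r = 0) → Eval P v (s j v) := by
    intro j
    induction j with
    | zero =>
      intro _
      refine ⟨skip, fun v _ => (eval_skip v).congr ?_⟩
      ext r
      simp only [s]
      rw [dif_neg (by lia)]
    | succ j ih =>
      intro hj
      obtain ⟨P, hP⟩ := ih (by lia)
      obtain ⟨Q, hQ⟩ := hg ⟨j, hj⟩ (k + n) a (k + j) (fun i => by have := ha i; lia) (by lia)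
        (fun i => by have := ha i; lia)
      refine ⟨seq P Q, fun v hv => (Eval.seq (hP v hv) (hQ _ ?_)).congr ?_⟩
      · intro r hr
        simp only [s]
        rw [dif_neg (by lia)]
        exact hv r (by lia)
      · have e : (fun i => s j v (a i)) = fun i => v (a i) := by
          ext i
          have := ha i
          simp only [s]
          rw [dif_neg (by lia)]
        ext r
        rw [e]
        simp only [s, update_apply]
        split_ifs with h1 h2 h2 h3 h3
        · subst h1; congr; lia
        · lia
        · rfl
        · lia
        · lia
        · rfl
  obtain ⟨P, hP⟩ := args n le_rfl
  obtain ⟨Q, hQ⟩ := hf (k + n) (fun i => k + i) b (fun i => by simp) (by lia)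
    (fun i => by lia)
  refine ⟨seq P (seq Q (clearRange k n)), fun v hv =>
    (Eval.seq (hP v hv) (.seq (hQ _ ?_) (eval_clearRange _ _ _))).congr ?_⟩
  · intro r hr
    simp only [s]
    rw [dif_neg (by lia)]
    exact hv r (by lia)
  · have e : (fun i : Fin n => s n v (k + i)) =
        fun i => g i (List.Vector.ofFn fun i => v (a i)) := by
      ext i
      have := i.2
      simp only [s]
      rw [dif_pos (by lia)]
      congr; simp
    ext r
    rw [e]
    simp only [s, update_apply]
    split_ifs with h1 h2 h3 h4
    · lia
    · exact (hv r h1.1).symm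
    · rfl
    · lia
    · rfl

theorem Computable.prec {n : ℕ} {f : List.Vector ℕ n → ℕ} {g : List.Vector ℕ (n + 2) → ℕ}
    (hf : Computable f) (hg : Computable g) :
    Computable fun v : List.Vector ℕ (n + 1) =>
      v.head.rec (f v.tail) fun y IH => g (y ::ᵥ IH ::ᵥ v.tail) := by
  intro k a b ha hb hab
  obtain ⟨P, hP⟩ := hf (k + 4) (fun i => a i.succ) (k + 1) (fun i => by have := ha i.succ; lia)
    (by lia) (fun i => by have := ha i.succ; lia)
  obtain ⟨Q, hQ⟩ := hg (k + 4) (Fin.cons k (Fin.cons (k + 1) fun i => a i.succ)) (k + 3)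
    (by
      intro i
      refine Fin.cases (by simp) (fun i => Fin.cases (by simp) (fun i => ?_) i) i
      have := ha i.succ
      simp only [Fin.cons_succ]; lia)
    (by lia)
    (by
      intro i
      refine Fin.cases (by simp) (fun i => Fin.cases (by simp) (fun i => ?_) i) i
      have := ha i.succ
      simp only [Fin.cons_succ]; lia)
  -- Register `k` holds the recursion index, `k + 1` the value reached, `k + 2` the number of rounds
  -- left, and `k + 3` the new value before it is copied.
  let body := seq Q (seq (copy (k + 3) (k + 1) (k + 4)) (seq (clear (k + 3)) (inc k)))
  -- At the end only `k` and `k + 1` need clearing: `k + 2` is `0` on leaving the loop, and each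
  -- round clears `k + 3`.
  refine ⟨seq P (seq (copy (a 0) (k + 2) (k + 3)) (seq (loop (k + 2) body)
    (seq (copy (k + 1) b (k + 3)) (clearRange k 2)))), fun v hv => ?_⟩
  have h0 := ha 0
  set N := v (a 0) with hN
  set T := List.Vector.ofFn fun i : Fin n => v (a i.succ) with hT
  let F : ℕ → ℕ := fun y => Nat.rec (f T) (fun y IH => g (y ::ᵥ IH ::ᵥ T)) y
  let s : ℕ → ℕ → ℕ := fun j => update (update (update v k (N - j)) (k + 1) (F (N - j))) (k + 2) j
  have e : (List.Vector.ofFn fun i => v (a i)) = N ::ᵥ T := by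
    rw [List.Vector.ofFn]
  have hloop : Eval (loop (k + 2) body) (s N) (s 0) := by
    refine Eval.loop_of_forall s N (by simp [s]) fun j hj => ?_
    refine (Eval.seq (hQ _ ?_) (.seq (eval_copy (by lia) (by lia) (by lia) ?_)
      (.seq (eval_clear _ _) (.inc _ _)))).congr ?_
    · intro r hr
      simp only [s, update_apply]
      have := hv r (by lia)
      split_ifs <;> lia
    · simp only [s, update_apply]
      have := hv (k + 4) (by lia)
      split_ifs <;> lia
    · have e' : (List.Vector.ofFn fun i : Fin (n + 2) => update (s (j + 1)) (k + 2) j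
          ((Fin.cons k (Fin.cons (k + 1) fun i => a i.succ) : Fin (n + 2) → ℕ) i)) =
          (N - (j + 1)) ::ᵥ F (N - (j + 1)) ::ᵥ T := by
        rw [List.Vector.ofFn, List.Vector.ofFn]
        congr 2
        · simp [s]
        · simp [s]
        · rw [hT]
          congr 1
          ext i
          have := ha i.succ
          simp only [Fin.cons_succ, s, update_apply]
          split_ifs <;> first | rfl | lia
      rw [e']
      have hF : g ((N - (j + 1)) ::ᵥ F (N - (j + 1)) ::ᵥ T) = F (N - j) := by
        rw [show N - j = N - (j + 1) + 1 by lia]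
      rw [hF]
      have h3 := hv (k + 3) (by lia)
      ext r
      simp only [s, update_apply]
      split_ifs <;> first | rfl | lia
  rw [e]
  refine (Eval.seq (hP v fun r hr => hv r (by lia)) (.seq (eval_copy (by lia) (by lia) (by lia) ?_)
    (.seq (v := s 0) ?_ (.seq (eval_copy (by lia) (by lia) (by lia) ?_)
      (eval_clearRange _ _ _))))).congr ?_
  · simp [hv]
  · convert hloop using 1
    ext r
    have h1 := hv k (by lia)
    simp only [s, update_apply]
    split_ifs <;> first | rfl | lia | simp [F, hT]
  · simp [s, hv]
  · ext r
    simp only [s, update_apply, List.Vector.head_cons, List.Vector.tail_cons]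
    have h1 := hv k (by lia)
    have h2 := hv (k + 1) (by lia)
    have h3 := hv (k + 2) (by lia)
    split_ifs <;> first | rfl | lia |
      (obtain rfl | rfl : r = k ∨ r = k + 1 := by lia
       all_goals lia)

theorem computable_of_primrec {n : ℕ} {f : List.Vector ℕ n → ℕ} (hf : Nat.Primrec' f) :
    Computable f := by
  induction hf with
  | zero => exact fun k a b _ hb _ => ⟨clear b, fun v _ => eval_clear b v⟩
  | succ =>
    intro k a b ha hb hab
    have h0 := ha 0
    refine ⟨seq (copy (a 0) b k) (inc b), fun v hv =>
      (Eval.seq (eval_copy (hab 0) (by lia) (by lia) (hv k le_rfl)) (.inc _ _)).congr ?_⟩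
    simp [List.Vector.ofFn]
  | get i =>
    intro k a b ha hb hab
    have h0 := ha i
    refine ⟨copy (a i) b k, fun v hv =>
      (eval_copy (hab i) (by lia) (by lia) (hv k le_rfl)).congr ?_⟩
    simp
  | comp g _ _ ihf ihg => exact ihf.comp ihg
  | prec _ _ ihf ihg => exact ihf.prec ihg

end LoopProg

/-! ### A universal loop program. -/

namespace LoopProg

open Function

/-- Search for a zero of a primitive recursive function. -/
theorem exists_eval_iff_exists_eq_zero {g : List.Vector ℕ 2 → ℕ} (hg : Nat.Primrec' g) :
    ∃ P, ∀ n, (∃ w, Eval P (Pi.single 0 n) w) ↔ ∃ y, g (y ::ᵥ n ::ᵥ .nil) = 0 := by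
  obtain ⟨G, hG⟩ := computable_of_primrec hg 3 ![1, 0] 2
    (by intro i; fin_cases i <;> simp) (by simp) (by intro i; fin_cases i <;> simp)
  let s : ℕ → ℕ → ℕ → ℕ → ℕ := fun n y t r =>
    if r = 0 then n else if r = 1 then y else if r = 2 then t else 0
  have hbody : ∀ n y t, Eval (seq G (inc 1)) (update (s n y t) 2 (t - 1))
      (s n (y + 1) (g (y ::ᵥ n ::ᵥ .nil))) := by
    intro n y t
    refine (Eval.seq (hG _ ?_) (.inc _ _)).congr ?_
    · intro r hr
      simp only [s, update_apply]
      split_ifs <;> lia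
    · have e : (List.Vector.ofFn fun i : Fin 2 => update (s n y t) 2 (t - 1)
          ((![1, 0] : Fin 2 → ℕ) i)) = y ::ᵥ n ::ᵥ .nil := by
        simp [List.Vector.ofFn, s]
      rw [e]
      ext r
      simp only [s, update_apply]
      split_ifs <;> first | rfl | lia
  have hs : ∀ n, Eval (inc 2) (Pi.single 0 n) (s n 0 1) := fun n =>
    (Eval.inc _ _).congr (by
      ext r
      simp only [s, update_apply, Pi.single_apply]
      split_ifs <;> first | rfl | lia)
  -- Register `2` holds the last value of `g`; the initial increment forces the loop to be entered.
  refine ⟨seq (inc 2) (loop 2 (seq G (inc 1))), fun n => ⟨?_, ?_⟩⟩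
  · rintro ⟨w, h⟩
    cases h with
    | seq h1 h2 =>
      rw [h1.det (hs n)] at h2
      -- The invariant is the implication from `t = 0`: the loop register vanishes only after a zero
      -- of `g` was met.
      have key : ∀ P u w, Eval P u w → P = loop 2 (seq G (inc 1)) → ∀ y t, u = s n y t →
          (t = 0 → ∃ y, g (y ::ᵥ n ::ᵥ .nil) = 0) → ∃ y, g (y ::ᵥ n ::ᵥ .nil) = 0 := by
        intro P u w h
        induction h with
        | inc | dec | seq => intro h; cases h
        | loop_zero h0 =>
          rintro h y t rfl ht
          cases h
          exact ht (by simpa [s] using h0)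
        | loop_pos h0 h1 h2 ih1 ih2 =>
          rintro h y t rfl ht
          cases h
          have h3 := h1.det (hbody n y t)
          exact ih2 rfl (y + 1) _ h3 fun h => ⟨y, h⟩
      exact key _ _ _ h2 rfl 0 1 rfl (by simp)
  · rintro ⟨y, hy⟩
    -- Here `d` is the distance to the known zero `y`; the loop may stop earlier, at a smaller zero.
    have key : ∀ d j t, j + d = y → ∃ w, Eval (loop 2 (seq G (inc 1))) (s n j t) w := by
      intro d
      induction d with
      | zero =>
        rintro j t rfl
        by_cases ht : t = 0
        · exact ⟨_, .loop_zero (by simpa [s] using ht)⟩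
        · exact ⟨_, .loop_pos (by simpa [s] using ht) (hbody n j t)
            (.loop_zero (by simpa [s] using hy))⟩
      | succ d ih =>
        intro j t h
        by_cases ht : t = 0
        · exact ⟨_, .loop_zero (by simpa [s] using ht)⟩
        · obtain ⟨w, hw⟩ := ih (j + 1) (g (j ::ᵥ n ::ᵥ .nil)) (by lia)
          exact ⟨w, .loop_pos (by simpa [s] using ht) (hbody n j t) hw⟩
    obtain ⟨w, hw⟩ := key y 0 1 (by simp)
    exact ⟨w, .seq (hs n) hw⟩

open Nat.Partrec in
/-- A program whose halting problem is that of the partial recursive functions. -/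
theorem exists_eval_iff_dom :
    ∃ P, ∀ n, (∃ w, Eval P (Pi.single 0 n) w) ↔
      (Code.eval (Denumerable.ofNat Code n) 0).Dom := by
  let g : ℕ → ℕ → ℕ := fun k n =>
    if (Code.evaln k (Denumerable.ofNat Code n) 0).isSome then 0 else 1
  have hg : Primrec₂ g := by
    refine Primrec.ite ?_ (.const 0) (.const 1)
    refine Primrec.eq.comp (Primrec.option_isSome.comp ?_) (.const true)
    exact Code.primrec_evaln.comp
      (.pair (.pair .fst ((Primrec.ofNat Code).comp .snd)) (.const 0))
  obtain ⟨P, hP⟩ := exists_eval_iff_exists_eq_zero (Nat.Primrec'.prim_iff₂.2 hg)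
  refine ⟨P, fun n => (hP n).trans ?_⟩
  simp only [List.Vector.head_cons, List.Vector.tail_cons, Part.dom_iff_mem, Code.evaln_complete, g]
  constructor
  · rintro ⟨k, hk⟩
    split_ifs at hk with h
    obtain ⟨x, hx⟩ := Option.isSome_iff_exists.1 h
    exact ⟨x, k, hx⟩
  · rintro ⟨x, k, hx⟩
    exact ⟨k, if_pos (Option.isSome_iff_exists.2 ⟨x, hx⟩)⟩

/-- All registers of a program lie below its bound. -/
def bound : LoopProg → ℕ
  | inc r => r + 1
  | dec r => r + 1
  | seq P Q => max P.bound Q.bound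
  | loop r P => max (r + 1) P.bound

/-- The `1` accounts for `skip`, which uses register `0`. -/
theorem bound_clearRange_zero_le (n : ℕ) : (clearRange 0 n).bound ≤ max 1 n := by
  induction n with
  | zero => simp [clearRange, skip, bound]
  | succ n ih => simp only [clearRange, clear, skip, bound]; lia

end LoopProg

/-! ### Compilation to counter machines. -/

/-- Instructions of a counter machine with jumps to labels in `α`: `inc r a` increments `r` and
jumps to `a`; `dec r a b` decrements `r` and jumps to `a` if `r` is positive, else jumps to `b`. -/
inductive CounterInstr (α : Type) : Type
  | inc (r : ℕ) (a : α)
  | dec (r : ℕ) (a b : α)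

namespace CounterInstr

open Function

variable {α β : Type}

/-- The register of an instruction. -/
def reg : CounterInstr α → ℕ
  | inc r _ => r
  | dec r _ _ => r

/-- Renames the labels. -/
def map (f : α → β) : CounterInstr α → CounterInstr β
  | inc r a => inc r (f a)
  | dec r a b => dec r (f a) (f b)

@[simp] theorem reg_map (f : α → β) (i : CounterInstr α) : (i.map f).reg = i.reg := by
  cases i <;> rfl

/-- The label to jump to. -/
def next (v : ℕ → ℕ) : CounterInstr α → α
  | inc _ a => a
  | dec r a b => if v r = 0 then b else a

/-- The new register contents. -/
def act (v : ℕ → ℕ) : CounterInstr α → ℕ → ℕ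
  | inc r _ => update v r (v r + 1)
  | dec r _ _ => update v r (v r - 1)

@[simp] theorem next_map (f : α → β) (v : ℕ → ℕ) (i : CounterInstr α) :
    (i.map f).next v = f (i.next v) := by
  cases i
  · rfl
  · simp only [map, next]; split_ifs <;> rfl

@[simp] theorem act_map (f : α → β) (v : ℕ → ℕ) (i : CounterInstr α) :
    (i.map f).act v = i.act v := by
  cases i <;> rfl

end CounterInstr

/-- `CounterExec M a v n w`: the counter machine with the program `M`, started at the label `a` with
contents `v`, exits (label `none`) after `n` steps with contents `w`. -/
inductive CounterExec {Q : Type} (M : Q → CounterInstr (Option Q)) :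
    Option Q → (ℕ → ℕ) → ℕ → (ℕ → ℕ) → Prop
  | exit (v : ℕ → ℕ) : CounterExec M none v 0 v
  | step {q : Q} {v w : ℕ → ℕ} {n : ℕ} :
      CounterExec M ((M q).next v) ((M q).act v) n w → CounterExec M (some q) v (n + 1) w

namespace CounterExec

variable {Q Q' : Type} {M : Q → CounterInstr (Option Q)} {M' : Q' → CounterInstr (Option Q')}

/-- Execution of an embedded machine whose exits are redirected to `e`. -/
theorem embed {f : Q → Q'} {e : Option Q'}
    (hf : ∀ q, M' (f q) = (M q).map fun a => a.elim e (some ∘ f))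
    {a : Option Q} {u v w : ℕ → ℕ} {m n : ℕ} (h : CounterExec M a u m v)
    (h' : CounterExec M' e v n w) : CounterExec M' (a.elim e (some ∘ f)) u (m + n) w := by
  induction h with
  | exit => simpa using h'
  | @step q v w m _ ih =>
    rw [show m + 1 + n = m + n + 1 by lia]
    refine .step ?_
    rw [hf, CounterInstr.next_map, CounterInstr.act_map]
    exact ih h'

/-- The execution stays in the embedded copy until it exits, and is split there. The step counts
show that what follows a loop body is shorter than the whole, which drives the induction for `loop`.
-/
theorem of_embed {f : Q → Q'} {e : Option Q'}
    (hf : ∀ q, M' (f q) = (M q).map fun a => a.elim e (some ∘ f)) {n : ℕ} :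
    ∀ {a : Option Q} {u w : ℕ → ℕ}, CounterExec M' (a.elim e (some ∘ f)) u n w →
    ∃ m k v, m + k = n ∧ CounterExec M a u m v ∧ CounterExec M' e v k w := by
  induction n with
  | zero =>
    rintro (_ | q) u w h
    · exact ⟨0, 0, u, rfl, .exit u, h⟩
    · cases h
  | succ n ih =>
    rintro (_ | q) u w h
    · exact ⟨0, n + 1, u, by lia, .exit u, h⟩
    · cases h with
      | step h =>
        rw [hf, CounterInstr.next_map, CounterInstr.act_map] at h
        obtain ⟨m, k, v, rfl, h1, h2⟩ := ih h
        exact ⟨m + 1, k, v, by lia, .step h1, h2⟩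

end CounterExec

/-- Every loop program can be executed by a counter machine. -/
theorem LoopProg.exists_counterExec (P : LoopProg) :
    ∃ (Q : Type) (_ : Fintype Q) (M : Q → CounterInstr (Option Q)) (q₀ : Q),
      (∀ q, (M q).reg < P.bound) ∧
      ∀ v w, (∃ n, CounterExec M (some q₀) v n w) ↔ P.Eval v w := by
  induction P with
  | inc r =>
    refine ⟨Unit, inferInstance, fun _ => .inc r none, (), by simp [CounterInstr.reg, bound],
      fun v w => ⟨?_, ?_⟩⟩
    · rintro ⟨n, h⟩
      cases h with
      | step h => cases h with
        | exit => exact .inc r v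
    · rintro ⟨⟩
      exact ⟨_, .step (.exit _)⟩
  | dec r =>
    refine ⟨Unit, inferInstance, fun _ => .dec r none none, (), by simp [CounterInstr.reg, bound],
      fun v w => ⟨?_, ?_⟩⟩
    · rintro ⟨n, h⟩
      cases h with
      | step h =>
        simp only [CounterInstr.next, ite_self] at h
        cases h with
        | exit => exact .dec r v
    · rintro ⟨⟩
      refine ⟨1, .step ?_⟩
      simp only [CounterInstr.next, ite_self]
      exact .exit _
  | seq P₁ P₂ ih₁ ih₂ =>
    obtain ⟨Q₁, _, M₁, q₁, hM₁, h₁⟩ := ih₁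
    obtain ⟨Q₂, _, M₂, q₂, hM₂, h₂⟩ := ih₂
    let M : Q₁ ⊕ Q₂ → CounterInstr (Option (Q₁ ⊕ Q₂)) := Sum.elim
      (fun q => (M₁ q).map fun a => a.elim (some (.inr q₂)) (some ∘ .inl))
      (fun q => (M₂ q).map fun a => a.elim none (some ∘ .inr))
    have e₁ : ∀ q, M (.inl q) = (M₁ q).map fun a => a.elim (some (.inr q₂)) (some ∘ .inl) :=
      fun _ => rfl
    have e₂ : ∀ q, M (.inr q) = (M₂ q).map fun a => a.elim none (some ∘ .inr) := fun _ => rfl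
    refine ⟨Q₁ ⊕ Q₂, inferInstance, M, .inl q₁, ?_, fun v w => ⟨?_, ?_⟩⟩
    · rintro (q | q)
      · simpa [M, bound] using .inl (hM₁ q)
      · simpa [M, bound] using .inr (hM₂ q)
    · rintro ⟨n, h⟩
      obtain ⟨m, k, u, rfl, hm, hk⟩ := CounterExec.of_embed e₁ (a := some q₁) h
      obtain ⟨m', k', u', rfl, hm', hk'⟩ := CounterExec.of_embed e₂ (a := some q₂) hk
      cases hk'
      exact .seq ((h₁ _ _).1 ⟨_, hm⟩) ((h₂ _ _).1 ⟨_, hm'⟩)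
    · intro h
      cases h with
      | seq a b =>
        obtain ⟨m, hm⟩ := (h₁ _ _).2 a
        obtain ⟨k, hk⟩ := (h₂ _ _).2 b
        exact ⟨_, CounterExec.embed e₁ (a := some q₁) hm
          (CounterExec.embed e₂ (a := some q₂) hk (.exit _))⟩
  | loop r P ih =>
    obtain ⟨Q, _, M₁, q₁, hM₁, h₁⟩ := ih
    -- The new label `none` is the loop test, and the body's exits lead back to it as `some none`.
    -- Its `dec` supplies the decrement that precedes each round.
    let M : Option Q → CounterInstr (Option (Option Q)) := fun o => o.elim
      (.dec r (some (some q₁)) none)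
      (fun q => (M₁ q).map fun a => a.elim (some none) (some ∘ some))
    have e₁ : ∀ q, M (some q) = (M₁ q).map fun a => a.elim (some none) (some ∘ some) :=
      fun _ => rfl
    refine ⟨Option Q, inferInstance, M, none, ?_, fun v w => ⟨?_, ?_⟩⟩
    · rintro (_ | q)
      · simp [M, bound, CounterInstr.reg]
      · simpa [M, bound] using .inr (hM₁ q)
    · rintro ⟨n, h⟩
      induction n using Nat.strong_induction_on generalizing v with
      | h n ih =>
        cases h with
        | @step _ _ _ n h =>
          by_cases h0 : v r = 0
          · simp only [M, Option.elim, CounterInstr.next, CounterInstr.act, h0, if_true] at h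
            have e : Function.update v r (0 - 1) = v := by simp [h0]
            rw [e] at h
            cases h
            exact .loop_zero h0
          · simp only [M, Option.elim, CounterInstr.next, CounterInstr.act, h0, if_false] at h
            obtain ⟨m, k, u, rfl, hm, hk⟩ := CounterExec.of_embed e₁ (a := some q₁) h
            exact .loop_pos h0 ((h₁ _ _).1 ⟨_, hm⟩) (ih k (by lia) _ hk)
    · intro h
      generalize hL : loop r P = L at h
      induction h with
      | inc | dec | seq => cases hL
      | @loop_zero r P v h0 =>
        cases hL
        refine ⟨1, .step ?_⟩
        simp only [M, Option.elim, CounterInstr.next, CounterInstr.act, h0, if_true]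
        have e : Function.update v r (0 - 1) = v := by simp [h0]
        rw [e]
        exact .exit v
      | loop_pos h0 h2 _ _ ih =>
        cases hL
        obtain ⟨k, hk⟩ := ih rfl
        obtain ⟨m, hm⟩ := (h₁ _ _).2 h2
        refine ⟨m + k + 1, .step ?_⟩
        simp only [M, Option.elim, CounterInstr.next, CounterInstr.act, h0, if_false]
        exact CounterExec.embed e₁ (a := some q₁) hm hk

/-- A counter machine with an undecidable halting problem that exits with cleared counters. -/
theorem exists_counterExec_iff_dom :
    ∃ (Q : Type) (_ : Fintype Q) (M : Q → CounterInstr (Option Q)) (q₀ : Q) (R : ℕ),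
      0 < R ∧ (∀ q, (M q).reg < R) ∧
      (∀ v n w, CounterExec M (some q₀) v n w → ∀ r < R, w r = 0) ∧
      ∀ n, (∃ s w, CounterExec M (some q₀) (Pi.single 0 n) s w) ↔
        (Nat.Partrec.Code.eval (Denumerable.ofNat Nat.Partrec.Code n) 0).Dom := by
  obtain ⟨P, hP⟩ := LoopProg.exists_eval_iff_dom
  -- The appended block clears every register the program uses and itself uses none outside `max 1
  -- P.bound`, which therefore serves as `R`.
  obtain ⟨Q, hQ, M, q₀, hM, h⟩ := (P.seq (.clearRange 0 (max 1 P.bound))).exists_counterExec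
  refine ⟨Q, hQ, M, q₀, max 1 P.bound, by lia, fun q => ?_, ?_, fun n => ?_⟩
  · have := hM q
    have := LoopProg.bound_clearRange_zero_le (max 1 P.bound)
    simp only [LoopProg.bound] at *
    lia
  · intro v n w hw r hr
    cases (h _ _).1 ⟨n, hw⟩ with
    | seq a b =>
      rw [b.det (LoopProg.eval_clearRange _ _ _)]
      exact if_pos (by lia)
  · rw [← hP n]
    constructor
    · rintro ⟨s, w, hs⟩
      cases (h _ _).1 ⟨s, hs⟩ with
      | seq a b => exact ⟨_, a⟩
    · rintro ⟨w, hw⟩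
      obtain ⟨s, hs⟩ := (h _ _).2 (.seq hw (LoopProg.eval_clearRange _ _ _))
      exact ⟨s, _, hs⟩

/-! ### Lossy counter machines with a budget. -/

open Function in
theorem Finset.sum_update_add {ι : Type*} [DecidableEq ι] {s : Finset ι} {i : ι} (hi : i ∈ s)
    (f : ι → ℕ) (x : ℕ) : ∑ j ∈ s, update f i x j + f i = ∑ j ∈ s, f j + x := by
  rw [Finset.sum_update_of_mem hi, ← Finset.sum_sdiff (Finset.singleton_subset_iff.2 hi)]
  simp only [Finset.sum_singleton]
  lia

/-- Registers that do not occur are left unchanged. -/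
theorem CounterExec.eq_of_le {Q : Type} {M : Q → CounterInstr (Option Q)} {R : ℕ}
    (hM : ∀ q, (M q).reg < R) {a : Option Q} {v w : ℕ → ℕ} {s : ℕ} (h : CounterExec M a v s w) :
    ∀ r, R ≤ r → w r = v r := by
  induction h with
  | exit => exact fun _ _ => rfl
  | @step q v w s _ ih =>
    intro r hr
    rw [ih r hr]
    have := hM q
    cases hq : M q <;> rw [hq] at this <;> simp only [CounterInstr.reg] at this <;>
      exact Function.update_of_ne (by lia) _ _

namespace BudgetMachine

open Function Relation

/-- A configuration of a counter machine whose steps are paid from a budget. -/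
structure Config (Q : Type) where
  /-- The label to execute next. -/
  state : Option Q
  /-- What is left of the budget. -/
  budget : ℕ
  /-- What was spent. -/
  used : ℕ
  /-- The counters. -/
  regs : ℕ → ℕ

variable {Q : Type}

/-- The steps of a lossy counter machine that pays for each step, and, having exited, gets refunds
and may start again on a further input `n`. The zero test always succeeds, and clears the
counter. -/
inductive Step (M : Q → CounterInstr (Option Q)) (q₀ : Q) (n : ℕ) : Config Q → Config Q → Prop
  | inc {q : Q} {r : ℕ} {a : Option Q} (B U : ℕ) (v : ℕ → ℕ) : M q = .inc r a →
      Step M q₀ n ⟨some q, B + 2, U, v⟩ ⟨a, B, U + 1, update v r (v r + 1)⟩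
  | dec {q : Q} {r : ℕ} {a b : Option Q} (B U : ℕ) (v : ℕ → ℕ) : M q = .dec r a b → v r ≠ 0 →
      Step M q₀ n ⟨some q, B + 1, U, v⟩ ⟨a, B, U + 2, update v r (v r - 1)⟩
  | zero {q : Q} {r : ℕ} {a b : Option Q} (B U : ℕ) (v : ℕ → ℕ) : M q = .dec r a b →
      Step M q₀ n ⟨some q, B + 1, U, v⟩ ⟨b, B, U + 1, update v r 0⟩
  | refund (B U : ℕ) (v : ℕ → ℕ) : Step M q₀ n ⟨none, B, U + 1, v⟩ ⟨none, B + 1, U, v⟩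
  | restart (B U : ℕ) (v : ℕ → ℕ) :
      Step M q₀ n ⟨none, B + n, U, v⟩ ⟨some q₀, B, 0, update v 0 (v 0 + n)⟩

/-- The sum of the budget, what was spent, and the first `R` counters. -/
def Config.total (R : ℕ) (c : Config Q) : ℕ :=
  c.budget + c.used + ∑ r ∈ Finset.range R, c.regs r

/-- A bound for the number of steps before the next restart as long as the total is constant. -/
def Config.rank (R : ℕ) (c : Config Q) : ℕ :=
  c.state.elim c.used fun _ => c.total R + 1 + c.budget

variable {M : Q → CounterInstr (Option Q)} {q₀ : Q} {n R : ℕ} {c c' : Config Q}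

/-- The total does not see the counters from `R` on; this controls them separately. -/
theorem Step.regs_eq_zero (hR : 0 < R) (hM : ∀ q, (M q).reg < R) (h : Step M q₀ n c c')
    (hc : ∀ r, R ≤ r → c.regs r = 0) : ∀ r, R ≤ r → c'.regs r = 0 := by
  intro r hr
  cases h with
  | @inc q s a B U v hq =>
    have := hM q
    simp only [hq, CounterInstr.reg] at this
    simpa [update_apply, show r ≠ s by lia] using hc r hr
  | @dec q s a b B U v hq h0 =>
    have := hM q
    simp only [hq, CounterInstr.reg] at this
    simpa [update_apply, show r ≠ s by lia] using hc r hr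
  | @zero q s a b B U v hq =>
    have := hM q
    simp only [hq, CounterInstr.reg] at this
    simpa [update_apply, show r ≠ s by lia] using hc r hr
  | refund => exact hc r hr
  | restart => simpa [update_apply, show r ≠ 0 by lia] using hc r hr

/-- `inc` turns two budget tokens into a used one and a counter token; `dec` turns a budget token
and a counter token into two used ones; a refund moves one token. Tokens are lost only by a zero
test (the contents of the counter) and by a restart (what was not refunded). -/
theorem Step.total_le (hR : 0 < R) (hM : ∀ q, (M q).reg < R) (h : Step M q₀ n c c') :
    c'.total R ≤ c.total R := by
  cases h with
  | @inc q r a B U v hq =>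
    have := hM q
    simp only [hq, CounterInstr.reg] at this
    have := Finset.sum_update_add (Finset.mem_range.2 this) v (v r + 1)
    simp only [Config.total]
    lia
  | @dec q r a b B U v hq h0 =>
    have := hM q
    simp only [hq, CounterInstr.reg] at this
    have := Finset.sum_update_add (Finset.mem_range.2 this) v (v r - 1)
    simp only [Config.total]
    lia
  | @zero q r a b B U v hq =>
    have := hM q
    simp only [hq, CounterInstr.reg] at this
    have := Finset.sum_update_add (Finset.mem_range.2 this) v 0
    simp only [Config.total]
    lia
  | refund => simp only [Config.total]; lia
  | restart B U v =>
    have := Finset.sum_update_add (Finset.mem_range.2 hR) v (v 0 + n)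
    simp only [Config.total]
    lia

/-- A step that keeps the total is a restart or a faithful step. -/
theorem Step.of_total_eq (hM : ∀ q, (M q).reg < R) (h : Step M q₀ n c c')
    (e : c'.total R = c.total R) :
    (c.state = none ∧ c'.state = some q₀ ∧ c'.regs = update c.regs 0 (c.regs 0 + n)) ∨
      ((∀ k w, CounterExec M c'.state c'.regs k w →
        ∃ k', CounterExec M c.state c.regs k' w) ∧ c'.rank R < c.rank R) := by
  cases h with
  | @inc q r a B U v hq =>
    refine .inr ⟨fun k w h => ⟨k + 1, .step ?_⟩, ?_⟩
    · rw [hq]; exact h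
    -- Before the exit the budget falls while the total is fixed; at the exit the rank becomes
    -- `used`, which is at most the total.
    · rcases a with _ | a <;> simp only [Config.rank, Config.total, Option.elim] at * <;> lia
  | @dec q r a b B U v hq h0 =>
    refine .inr ⟨fun k w h => ⟨k + 1, .step ?_⟩, ?_⟩
    · rw [hq]; simpa [CounterInstr.next, CounterInstr.act, h0] using h
    · have := hM q
      simp only [hq, CounterInstr.reg] at this
      have := Finset.single_le_sum (f := v) (fun _ _ => Nat.zero_le _) (Finset.mem_range.2 this)
      rcases a with _ | a <;> simp only [Config.rank, Config.total, Option.elim] at * <;> lia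
  | @zero q r a b B U v hq =>
    have := hM q
    simp only [hq, CounterInstr.reg] at this
    have := Finset.sum_update_add (Finset.mem_range.2 this) v 0
    -- Clearing a positive counter would have lowered the total.
    have h0 : v r = 0 := by
      simp only [Config.total] at e
      lia
    refine .inr ⟨fun k w h => ⟨k + 1, .step ?_⟩, ?_⟩
    · rw [hq]; simpa [CounterInstr.next, CounterInstr.act, h0] using h
    · rcases b with _ | b <;> simp only [Config.rank, Config.total, Option.elim] at * <;> lia
  | refund =>
    refine .inr ⟨fun k w h => ⟨k, h⟩, ?_⟩
    simp only [Config.rank, Option.elim]; lia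
  | restart => exact .inl ⟨rfl, rfl, rfl⟩

/-- If the budget machine has an infinite run, then the counter machine halts on `n`. -/
theorem exists_counterExec_of_infinite (hR : 0 < R) (hM : ∀ q, (M q).reg < R)
    (hclear : ∀ v k w, CounterExec M (some q₀) v k w → ∀ r < R, w r = 0)
    (c : ℕ → Config Q) (h0 : ∀ r, R ≤ r → (c 0).regs r = 0)
    (hc : ∀ i, Step M q₀ n (c i) (c (i + 1))) :
    ∃ s w, CounterExec M (some q₀) (Pi.single 0 n) s w := by
  have hzero : ∀ i r, R ≤ r → (c i).regs r = 0 := by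
    intro i
    induction i with
    | zero => exact h0
    | succ i ih => exact (hc i).regs_eq_zero hR hM ih
  have hanti : Antitone fun i => (c i).total R :=
    antitone_nat_of_succ_le fun i => (hc i).total_le hR hM
  obtain ⟨N, hN⟩ : ∃ N, ∀ i, (c N).total R ≤ (c i).total R :=
    ⟨argmin fun i => (c i).total R, fun i => argmin_le (fun i => (c i).total R) i⟩
  have hconst : ∀ i, N ≤ i → (c (i + 1)).total R = (c i).total R := fun i hi =>
    le_antisymm (hanti (Nat.le_succ i)) ((hanti hi).trans (hN (i + 1)))
  -- By induction on the rank, only finitely many steps precede the next restart. They are faithful,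
  -- so they form an execution that ends in an exit.
  have hrestart : ∀ m i, N ≤ i → (c i).rank R = m → ∃ j, i ≤ j ∧
      (c (j + 1)).state = some q₀ ∧
      (c (j + 1)).regs = update (c j).regs 0 ((c j).regs 0 + n) ∧
      ∃ k, CounterExec M (c i).state (c i).regs k (c j).regs := by
    intro m
    induction m using Nat.strong_induction_on with
    | h m ih =>
      rintro i hi rfl
      rcases (hc i).of_total_eq hM (hconst i hi) with ⟨h1, h2, h3⟩ | ⟨h1, h2⟩
      · exact ⟨i, le_rfl, h2, h3, 0, by rw [h1]; exact .exit _⟩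
      · obtain ⟨j, hj, h3, h4, k, h5⟩ := ih _ h2 (i + 1) (by lia) rfl
        exact ⟨j, by lia, h3, h4, h1 _ _ h5⟩
  -- Three restarts are used: the run after the first starts on unknown contents but clears the
  -- counters, so the run after the second starts on exactly `n`, and it exits before the third.
  obtain ⟨j₁, hj₁, hs₁, -, -⟩ := hrestart _ N le_rfl rfl
  obtain ⟨j₂, hj₂, hs₂, hr₂, k₂, he₂⟩ := hrestart _ (j₁ + 1) (by lia) rfl
  obtain ⟨j₃, hj₃, -, -, k₃, he₃⟩ := hrestart _ (j₂ + 1) (by lia) rfl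
  rw [hs₁] at he₂
  have hz : (c j₂).regs = 0 := by
    ext r
    rcases lt_or_ge r R with h | h
    · exact hclear _ _ _ he₂ r h
    · exact hzero _ _ h
  rw [hs₂, hr₂, hz] at he₃
  refine ⟨k₃, (c j₃).regs, ?_⟩
  simpa [Pi.single] using he₃

/-- With a sufficient budget the budget machine executes the counter machine. -/
theorem exists_reflTransGen (hM : ∀ q, (M q).reg < R) {a : Option Q} {v w : ℕ → ℕ} {s : ℕ}
    (h : CounterExec M a v s w) (B U : ℕ) (hB : 2 * s ≤ B) :
    ∃ B' U', ReflTransGen (Step M q₀ n) ⟨a, B, U, v⟩ ⟨none, B', U', w⟩ ∧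
      B' + U' + ∑ r ∈ Finset.range R, w r = B + U + ∑ r ∈ Finset.range R, v r := by
  induction h generalizing B U with
  | exit v => exact ⟨B, U, .refl, rfl⟩
  | @step q v w s h ih =>
    have hr := hM q
    obtain ⟨B, rfl⟩ : ∃ B₀, B = B₀ + 2 := ⟨B - 2, by lia⟩
    cases hq : M q with
    | inc r a =>
      rw [hq] at hr ih
      obtain ⟨B', U', h1, h2⟩ := ih B (U + 1) (by lia)
      refine ⟨B', U', .head (.inc B U v hq) h1, ?_⟩
      have := Finset.sum_update_add (Finset.mem_range.2 hr) v (v r + 1)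
      simp only [CounterInstr.reg, CounterInstr.act] at *
      lia
    | dec r a b =>
      rw [hq] at hr ih
      have := Finset.sum_update_add (Finset.mem_range.2 hr) v (v r - 1)
      by_cases h0 : v r = 0
      · obtain ⟨B', U', h1, h2⟩ := ih (B + 1) (U + 1) (by lia)
        simp only [CounterInstr.reg, CounterInstr.act, CounterInstr.next, h0, if_true,
          zero_tsub] at *
        exact ⟨B', U', .head (.zero (B + 1) U v hq) h1, by lia⟩
      · obtain ⟨B', U', h1, h2⟩ := ih (B + 1) (U + 2) (by lia)
        simp only [CounterInstr.reg, CounterInstr.act, CounterInstr.next, if_neg h0] at *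
        exact ⟨B', U', .head (.dec (B + 1) U v hq h0) h1, by lia⟩

theorem reflTransGen_refund (B U : ℕ) (v : ℕ → ℕ) :
    ReflTransGen (Step M q₀ n) ⟨none, B, U, v⟩ ⟨none, B + U, 0, v⟩ := by
  induction U generalizing B with
  | zero => exact .refl
  | succ U ih =>
    rw [show B + (U + 1) = B + 1 + U by lia]
    exact .head (.refund B U v) (ih (B + 1))

/-- If the counter machine halts on `n`, then the budget machine has a cycle. -/
theorem exists_cycle (hR : 0 < R) (hM : ∀ q, (M q).reg < R)
    (hclear : ∀ v k w, CounterExec M (some q₀) v k w → ∀ r < R, w r = 0) {s : ℕ} {w : ℕ → ℕ}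
    (h : CounterExec M (some q₀) (Pi.single 0 n) s w) :
    ∃ B, TransGen (Step M q₀ n) ⟨none, B, 0, 0⟩ ⟨none, B, 0, 0⟩ := by
  have hw : w = 0 := by
    ext r
    rcases lt_or_ge r R with hr | hr
    · exact hclear _ _ _ h r hr
    · rw [h.eq_of_le hM r hr]
      simp [show r ≠ 0 by lia]
  obtain ⟨B', U', h1, h2⟩ := exists_reflTransGen (q₀ := q₀) (n := n) hM h (2 * s) 0 le_rfl
  -- The restart costs `n` and each of the `s` steps at most `2`. The total is conserved and the
  -- final counters are empty, so refunds restore exactly this budget.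
  refine ⟨2 * s + n, .head' (.restart (2 * s) 0 0) ?_⟩
  have e : B' + U' = 2 * s + n := by
    simpa [hw, hR.ne', Pi.single_apply, hR] using h2
  rw [← e]
  refine .trans ?_ (reflTransGen_refund B' U' 0)
  rw [← hw]
  convert h1 using 2
  simp [Pi.single, hw]

end BudgetMachine

/-! ### Actions and their realisation by resets or by transfers. -/

namespace OmegaNet

/-- A transition that consumes and produces fixed numbers of tokens, except that it may empty the
place `clear`, and may produce any number of tokens on the place `pump`. -/
structure Action (π : Type) where
  /-- The numbers of tokens to consume. -/
  pre : π → ℕ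
  /-- The numbers of tokens to produce. -/
  post : π → ℕ
  /-- The place to empty. -/
  clear : Option π
  /-- The place that receives an arbitrary number of tokens. -/
  pump : Option π

namespace Action

variable {π : Type} {k : ℕ}

open Classical in
/-- The firing relation of an action. -/
def Fires (a : Action π) (m m' : π → ℕ) : Prop :=
  ∃ d : ℕ, (∀ p, a.clear ≠ some p → a.pre p ≤ m p) ∧
    ∀ p, m' p = (if a.clear = some p then 0 else m p - a.pre p) +
      if a.pump = some p then d else a.post p

open Classical in
/-- The input label of a place. The place `none` is an additional one, which collects the transferred
tokens. If `T` is true, then transfers are used, else resets. -/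
noncomputable def inLabel (T : Bool) (a : Action π) : Option π → InLabel
  | none => .num 0
  | some p => if a.clear = some p then (if T then .transfer else .reset) else .num (a.pre p)

open Classical in
/-- The output label of a place. -/
noncomputable def outLabel (T : Bool) (a : Action π) : Option π → OutLabel
  | none => if T ∧ a.clear ≠ none then .transfer else .num 0
  | some p => if a.pump = some p then .omega else .num (a.post p)

variable {T : Bool} {a : Action π} {z : Option π}

theorem inLabel_eq_transfer :
    a.inLabel T z = .transfer ↔ T = true ∧ z ≠ none ∧ a.clear = z := by
  rcases z with _ | p
  · simp [inLabel]
  · simp only [inLabel]; split_ifs <;> simp_all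

theorem inLabel_eq_reset : a.inLabel T z = .reset ↔ T = false ∧ z ≠ none ∧ a.clear = z := by
  rcases z with _ | p
  · simp [inLabel]
  · simp only [inLabel]; split_ifs <;> simp_all

theorem inLabel_ne_omega : a.inLabel T z ≠ .omega := by
  rcases z with _ | p
  · simp [inLabel]
  · simp only [inLabel]; split_ifs <;> simp_all

theorem outLabel_eq_transfer :
    a.outLabel T z = .transfer ↔ T = true ∧ z = none ∧ a.clear ≠ none := by
  rcases z with _ | p
  · simp only [outLabel]; split_ifs <;> simp_all
  · simp only [outLabel]; split_ifs <;> simp_all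

theorem outLabel_eq_omega : a.outLabel T z = .omega ↔ z ≠ none ∧ a.pump = z := by
  rcases z with _ | p
  · simp only [outLabel]; split_ifs <;> simp_all
  · simp only [outLabel]; split_ifs <;> simp_all

/-- The transition of an action. -/
noncomputable def toTransition (T : Bool) (σ : Option π ≃ Fin k) (a : Action π) : Transition k where
  input x := a.inLabel T (σ.symm x)
  output x := a.outLabel T (σ.symm x)
  input_special := by
    intro x hx y hy
    simp only [Set.mem_ofPred_eq, inLabel_eq_transfer, inLabel_eq_reset] at hx hy
    exact σ.symm.injective (by grind)
  output_special := by
    intro x hx y hy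
    simp only [Set.mem_ofPred_eq, outLabel_eq_transfer] at hx hy
    exact σ.symm.injective (by grind)
  transfer_iff := by
    simp only [inLabel_eq_transfer, outLabel_eq_transfer]
    constructor
    · rintro ⟨x, h1, h2, h3⟩
      exact ⟨σ none, h1, by simp, h3 ▸ h2⟩
    · rintro ⟨x, h1, h2, h3⟩
      exact ⟨σ a.clear, h1, by simpa using h3, by simp⟩
  reset_output := by
    rintro ⟨x, hx⟩ y hy
    rw [inLabel_eq_reset] at hx
    rw [outLabel_eq_transfer] at hy
    simp [hx.1] at hy

theorem toTransition_input (T : Bool) (σ : Option π ≃ Fin k) (a : Action π) (z : Option π) :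
    (a.toTransition T σ).input (σ z) = a.inLabel T z := by
  simp [toTransition]

theorem toTransition_output (T : Bool) (σ : Option π ≃ Fin k) (a : Action π) (z : Option π) :
    (a.toTransition T σ).output (σ z) = a.outLabel T z := by
  simp [toTransition]

theorem fires_of_toTransition {σ : Option π ≃ Fin k} {e e' : Marking k}
    (h : OmegaNet.Fires (a.toTransition T σ) e e') :
    a.Fires (fun p => e (σ (some p))) fun p => e' (σ (some p)) := by
  obtain ⟨mI, mO, hI, hO, he⟩ := h
  -- Without a pumped place the value of `d` is irrelevant.
  refine ⟨a.pump.elim 0 fun p => mO (σ (some p)), fun p hp => ?_, fun p => ?_⟩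
  · have := hI (σ (some p))
    simp only [toTransition_input, inLabel, if_neg hp, Consumes] at this
    exact this.1
  · have h1 := hI (σ (some p))
    have h2 := hO (σ (some p))
    refine (he _).trans ?_
    rw [toTransition_input, inLabel] at h1
    rw [toTransition_output, outLabel] at h2
    congr 1
    · split_ifs at h1 ⊢ <;> simp only [Consumes] at h1 <;> lia
    · split_ifs at h2 ⊢ with h
      · simp [h]
      · exact h2

/-- The extra place has input label `num 0`, so its contents never prevent firing and `e` is
arbitrary there. -/
theorem exists_fires_toTransition (T : Bool) (σ : Option π ≃ Fin k) {m m' : π → ℕ}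
    (h : a.Fires m m') {e : Marking k} (he : ∀ p, e (σ (some p)) = m p) :
    ∃ e', OmegaNet.Fires (a.toTransition T σ) e e' ∧ ∀ p, e' (σ (some p)) = m' p := by
  classical
  obtain ⟨d, h1, h2⟩ := h
  let mI : Option π → ℕ := fun z => z.elim 0 fun p => if a.clear = some p then m p else a.pre p
  -- With transfers, the extra place receives what the cleared place held.
  let mO : Option π → ℕ := fun z => z.elim
    (if T then a.clear.elim 0 m else 0) fun p => if a.pump = some p then d else a.post p
  refine ⟨fun x => e x - mI (σ.symm x) + mO (σ.symm x),
    ⟨fun x => mI (σ.symm x), fun x => mO (σ.symm x), fun x => ?_, fun x => ?_, fun _ => rfl⟩,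
    fun p => ?_⟩
  · obtain ⟨z, rfl⟩ := σ.surjective x
    rcases z with _ | p
    · simp [toTransition, inLabel, Consumes, mI]
    · simp only [toTransition, Equiv.symm_apply_apply, inLabel, mI, Option.elim]
      split_ifs with h3
      · exact (he p).symm
      · exact (he p).symm
      · exact ⟨(he p).symm ▸ h1 p h3, rfl⟩
  · obtain ⟨z, rfl⟩ := σ.surjective x
    rcases z with _ | p
    · rw [toTransition_output, outLabel]
      simp only [mO, Equiv.symm_apply_apply, Option.elim_none]
      split_ifs with h3 h4 h4
      · obtain ⟨p, hp⟩ := Option.ne_none_iff_exists'.1 h3.2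
        refine ⟨σ (some p), ?_, by simp [hp, he]⟩
        rw [toTransition_input]
        exact inLabel_eq_transfer.2 (by simp [hp, h4])
      · exact absurd h3.1 h4
      · have : a.clear = none := by simpa [h4] using h3
        simp [this, Produces]
      · rfl
    · rw [toTransition_output, outLabel]
      simp only [mO, Equiv.symm_apply_apply, Option.elim_some]
      split_ifs <;> simp [Produces]
  · rw [h2 p]
    simp only [Equiv.symm_apply_apply, mI, mO, Option.elim, he]
    split_ifs <;> lia

end Action

/-! ### Nets given by actions. -/

section ActionNet

variable {π ι : Type} [Fintype ι] {k : ℕ}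

open Classical in
/-- The net whose transitions are given by the action `a` and by those of the family `L`. -/
noncomputable abbrev actionNet (T : Bool) (σ : Option π ≃ Fin k) (a : Action π) (L : ι → Action π)
    (m₀ : π → ℕ) (h : ∀ i, (L i).toTransition T σ ≠ a.toTransition T σ) : Net where
  places := k
  -- Different indices may give the same transition; the `Finset` image removes repetitions.
  transitions := a.toTransition T σ ::
    (Finset.univ.image fun i => (L i).toTransition T σ).toList
  nodup := by
    rw [List.nodup_cons]
    exact ⟨by simpa using h, Finset.nodup_toList _⟩
  init x := (σ.symm x).elim 0 m₀

variable {T : Bool} {σ : Option π ≃ Fin k} {a : Action π} {L : ι → Action π} {m₀ : π → ℕ}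
  {h : ∀ i, (L i).toTransition T σ ≠ a.toTransition T σ}

theorem mem_actionNet_transitions {t : Transition k} :
    t ∈ (actionNet T σ a L m₀ h).transitions ↔
      a.toTransition T σ = t ∨ ∃ i, (L i).toTransition T σ = t := by
  simp only [actionNet, List.mem_cons, Finset.mem_toList, Finset.mem_image, Finset.mem_univ,
    true_and, eq_comm (a := t)]

/-- Executions correspond by forgetting the extra place in one direction and recomputing its
contents step by step in the other. -/
theorem actionNet_terminates_iff :
    (actionNet T σ a L m₀ h).Terminates ↔ ¬ ∃ m : ℕ → π → ℕ, m 0 = m₀ ∧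
      ∀ i, a.Fires (m i) (m (i + 1)) ∨ ∃ j, (L j).Fires (m i) (m (i + 1)) := by
  refine not_congr ⟨?_, ?_⟩
  · rintro ⟨e, t, h0, h1⟩
    refine ⟨fun i p => e i (σ (some p)), ?_, fun i => ?_⟩
    · ext p
      simp [h0]
    · obtain ⟨h2, h3⟩ := h1 i
      rcases mem_actionNet_transitions.1 h2 with h4 | ⟨j, h4⟩
      · exact .inl (Action.fires_of_toTransition (h4.symm ▸ h3))
      · exact .inr ⟨j, Action.fires_of_toTransition (h4.symm ▸ h3)⟩
  · rintro ⟨m, h0, h1⟩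
    have step : ∀ i (e : Marking k), (∀ p, e (σ (some p)) = m i p) → ∃ e' : Marking k,
        (∀ p, e' (σ (some p)) = m (i + 1) p) ∧
        ∃ t ∈ (actionNet T σ a L m₀ h).transitions, Fires t e e' := by
      intro i e he
      rcases h1 i with h2 | ⟨j, h2⟩
      · obtain ⟨e', h3, h4⟩ := Action.exists_fires_toTransition T σ h2 he
        exact ⟨e', h4, _, mem_actionNet_transitions.2 (.inl rfl), h3⟩
      · obtain ⟨e', h3, h4⟩ := Action.exists_fires_toTransition T σ h2 he
        exact ⟨e', h4, _, mem_actionNet_transitions.2 (.inr ⟨j, rfl⟩), h3⟩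
    choose f hf t ht hfire using step
    let e : (i : ℕ) → {e : Marking k // ∀ p, e (σ (some p)) = m i p} := fun i =>
      Nat.rec ⟨(actionNet T σ a L m₀ h).init, fun p => by simp [h0]⟩
        (fun i e => ⟨f i e.1 e.2, hf i e.1 e.2⟩) i
    exact ⟨fun i => (e i).1, fun i => t i (e i).1 (e i).2, rfl, fun i => ⟨ht _ _ _, hfire _ _ _⟩⟩

theorem actionNet_noOmegaInput : (actionNet T σ a L m₀ h).NoOmegaInput := by
  intro t ht p
  rcases mem_actionNet_transitions.1 ht with rfl | ⟨i, rfl⟩ <;> exact Action.inLabel_ne_omega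

theorem actionNet_isOmegaOPNT (hT : T = true) : (actionNet T σ a L m₀ h).IsOmegaOPNT := by
  refine ⟨fun t ht p hp => ?_, actionNet_noOmegaInput⟩
  rcases mem_actionNet_transitions.1 ht with rfl | ⟨i, rfl⟩ <;>
    simpa [hT] using (Action.inLabel_eq_reset.1 hp).1

theorem actionNet_isOmegaOPNR (hT : T = false) : (actionNet T σ a L m₀ h).IsOmegaOPNR := by
  refine ⟨fun t ht p hp => ?_, actionNet_noOmegaInput⟩
  rcases mem_actionNet_transitions.1 ht with rfl | ⟨i, rfl⟩ <;>
    simpa [hT] using (Action.inLabel_eq_transfer.1 hp).1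

theorem actionNet_hasOneOmegaOutputArc (ha : a.pump = none) (i₀ : ι) (p₀ : π)
    (hp₀ : (L i₀).pump = some p₀) (hL : ∀ i, i ≠ i₀ → (L i).pump = none) :
    (actionNet T σ a L m₀ h).HasOneOmegaOutputArc := by
  have e : (actionNet T σ a L m₀ h).omegaOutputArcs =
      {((L i₀).toTransition T σ, σ (some p₀))} := by
    ext ⟨t, x⟩
    rw [Set.mem_singleton_iff, Prod.mk.injEq]
    constructor
    · rintro ⟨h1, h2⟩
      rcases mem_actionNet_transitions.1 h1 with rfl | ⟨i, rfl⟩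
      · obtain ⟨h3, h4⟩ := Action.outLabel_eq_omega.1 h2
        exact absurd (h4.symm.trans ha) h3
      · obtain ⟨h3, h4⟩ := Action.outLabel_eq_omega.1 h2
        by_cases hi : i = i₀
        · subst hi
          exact ⟨rfl, by rw [← hp₀, h4]; exact (σ.apply_symm_apply x).symm⟩
        · exact absurd (h4.symm.trans (hL i hi)) h3
    · rintro ⟨rfl, rfl⟩
      refine ⟨mem_actionNet_transitions.2 (.inr ⟨i₀, rfl⟩), ?_⟩
      exact Action.outLabel_eq_omega.2 (by simp [hp₀])
  rw [Net.HasOneOmegaOutputArc, e]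
  exact Set.ncard_singleton _

/-- Only the head transition varies with `n`, and the places it clears and pumps do not. So each
label code is constant or a computable number shifted by `3`. The rest of the code is a constant,
which makes the non-constructive choice of the list harmless. -/
theorem computable_actionNet_code (a : ℕ → Action π) (c d : Option π)
    (hc : ∀ n, (a n).clear = c) (hd : ∀ n, (a n).pump = d)
    (hpre : ∀ p, Computable fun n => (a n).pre p) (hpost : ∀ p, Computable fun n => (a n).post p)
    (h : ∀ n i, (L i).toTransition T σ ≠ (a n).toTransition T σ) :
    Computable fun n => (actionNet T σ (a n) L m₀ (h n)).code := by
  have hin : ∀ z, Computable fun n => ((a n).inLabel T z).code := by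
    rintro (_ | p)
    · exact .const 3
    · by_cases hp : c = some p
      · exact (Computable.const (if T then 1 else 2)).of_eq fun n => by
          rw [Action.inLabel, if_pos ((hc n).trans hp)]
          cases T <;> rfl
      · exact ((Primrec.nat_add.comp .id (.const 3)).to_comp.comp (hpre p)).of_eq fun n => by
          rw [Action.inLabel, if_neg ((hc n).symm ▸ hp)]
          rfl
  have hout : ∀ z, Computable fun n => ((a n).outLabel T z).code := by
    rintro (_ | p)
    · exact (Computable.const (if T ∧ c ≠ none then 1 else 3)).of_eq fun n => by
        simp only [Action.outLabel, hc]; split_ifs <;> rfl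
    · by_cases hp : d = some p
      · exact (Computable.const 0).of_eq fun n => by
          rw [Action.outLabel, if_pos ((hd n).trans hp)]
          rfl
      · exact ((Primrec.nat_add.comp .id (.const 3)).to_comp.comp (hpost p)).of_eq fun n => by
          rw [Action.outLabel, if_neg ((hd n).symm ▸ hp)]
          rfl
  have hcode : Computable fun n => ((a n).toTransition T σ).code :=
    .pair (Computable.list_ofFn fun _ => hin _) (Computable.list_ofFn fun _ => hout _)
  classical
  exact .pair (.const k) (.pair (Computable.list_cons.comp hcode (.const
    (List.map Transition.code (Finset.univ.image fun i => (L i).toTransition T σ).toList)))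
    (.const (List.ofFn fun x => (σ.symm x).elim 0 m₀)))

end ActionNet

end OmegaNet

/-! ### The net of a budget machine. -/

namespace BudgetMachine

open Function Relation OmegaNet

/-- The places of the net that simulates a budget machine. -/
inductive Place (Q : Type) (R : ℕ) : Type
  | start
  | budget
  | used
  | state (o : Option Q)
  | ctr (r : Fin R)

open Classical in
noncomputable instance {Q : Type} [Fintype Q] {R : ℕ} : Fintype (Place Q R) :=
  Fintype.ofSurjective (α := Fin 3 ⊕ Option Q ⊕ Fin R)
    (Sum.elim ![.start, .budget, .used] (Sum.elim .state .ctr)) (by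
      rintro (_ | _ | _ | o | r)
      · exact ⟨.inl 0, rfl⟩
      · exact ⟨.inl 1, rfl⟩
      · exact ⟨.inl 2, rfl⟩
      · exact ⟨.inr (.inl o), rfl⟩
      · exact ⟨.inr (.inr r), rfl⟩)

/-- The transitions of the net that simulates a budget machine, but for the restart. -/
inductive Rule (Q : Type) : Type
  | launch
  | refund
  | fire (q : Q)
  | zero (q : Q)

open Classical in
noncomputable instance {Q : Type} [Fintype Q] : Fintype (Rule Q) :=
  Fintype.ofSurjective (α := Fin 2 ⊕ Q ⊕ Q)
    (Sum.elim ![.launch, .refund] (Sum.elim .fire .zero)) (by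
      rintro (_ | _ | q | q)
      · exact ⟨.inl 0, rfl⟩
      · exact ⟨.inl 1, rfl⟩
      · exact ⟨.inr (.inl q), rfl⟩
      · exact ⟨.inr (.inr q), rfl⟩)

variable {Q : Type} {R n : ℕ} {q₀ : Q} {M : Q → CounterInstr (Option Q)}

/-- A marking given by its values on the places. -/
def marking (s b u : ℕ) (f : Option Q → ℕ) (v : ℕ → ℕ) : Place Q R → ℕ
  | .start => s
  | .budget => b
  | .used => u
  | .state o => f o
  | .ctr r => v r

open Classical in
/-- The marking of a configuration. -/
noncomputable def Config.marking (c : Config Q) : Place Q R → ℕ :=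
  BudgetMachine.marking 0 c.budget c.used (Pi.single c.state 1) c.regs

/-- The place of the counter `r`. -/
def ctrPlace (Q : Type) (R r : ℕ) : Option (Place Q R) :=
  if h : r < R then some (.ctr ⟨r, h⟩) else none

open Classical in
/-- The action that starts the counter machine on a further input `n`. -/
noncomputable def restartAction (R : ℕ) (q₀ : Q) (n : ℕ) : Action (Place Q R) where
  pre := marking 0 n 0 (Pi.single none 1) 0
  post := marking 0 0 0 (Pi.single (some q₀) 1) (Pi.single 0 n)
  clear := some .used
  pump := none

open Classical in
/-- The action that executes an instruction; a `dec` instruction only if the counter is positive. -/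
noncomputable def fireAction (R : ℕ) (q : Q) : CounterInstr (Option Q) → Action (Place Q R)
  | .inc r a =>
    { pre := marking 0 2 0 (Pi.single (some q) 1) 0
      post := marking 0 0 1 (Pi.single a 1) (Pi.single r 1)
      clear := none
      pump := none }
  | .dec r a _ =>
    { pre := marking 0 1 0 (Pi.single (some q) 1) (Pi.single r 1)
      post := marking 0 0 2 (Pi.single a 1) 0
      clear := none
      pump := none }

open Classical in
/-- The action that executes a `dec` instruction after clearing the counter. -/
noncomputable def zeroAction (R : ℕ) (q : Q) : CounterInstr (Option Q) → Action (Place Q R)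
  -- An `inc` has no zero branch; repeating its action adds no behaviour.
  | .inc r a => fireAction R q (.inc r a)
  | .dec r _ b =>
    { pre := marking 0 1 0 (Pi.single (some q) 1) 0
      post := marking 0 0 1 (Pi.single b 1) 0
      clear := ctrPlace Q R r
      pump := none }

open Classical in
/-- The actions other than the restart. -/
noncomputable def ruleAction (R : ℕ) (M : Q → CounterInstr (Option Q)) :
    Rule Q → Action (Place Q R)
  | .launch =>
    { pre := marking 1 0 0 0 0
      post := marking 0 0 0 (Pi.single none 1) 0
      clear := none
      pump := some .budget }
  | .refund =>
    { pre := marking 0 0 1 (Pi.single none 1) 0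
      post := marking 0 1 0 (Pi.single none 1) 0
      clear := none
      pump := none }
  | .fire q => fireAction R q (M q)
  | .zero q => zeroAction R q (M q)

/-- The initial marking. -/
def initMarking : Place Q R → ℕ := marking 1 0 0 0 0

theorem fires_restartAction {c : Config Q} {m : Place Q R → ℕ}
    (h : (restartAction R q₀ n).Fires c.marking m) :
    ∃ c', m = c'.marking ∧ Step M q₀ n c c' := by
  obtain ⟨o, b, u, v⟩ := c
  obtain ⟨d, h1, h2⟩ := h
  have hs := h1 (.state none) (by simp [restartAction])
  have hb := h1 .budget (by simp [restartAction])
  simp only [restartAction, marking, Config.marking, Pi.single_apply] at hs hb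
  obtain rfl : o = none := by
    by_contra h
    simp [Ne.symm h] at hs
  obtain ⟨b, rfl⟩ := Nat.exists_eq_add_of_le' hb
  refine ⟨_, ?_, .restart b u v⟩
  ext p
  rw [h2 p]
  cases p with
  | state o => simp [restartAction, marking, Config.marking, Pi.single_apply]
  | ctr r =>
    by_cases hr : (r : ℕ) = 0 <;>
      simp [restartAction, marking, Config.marking, hr]
  | _ => simp [restartAction, marking, Config.marking]

theorem fires_fireAction {q : Q} (hM : (M q).reg < R) {c : Config Q} {m : Place Q R → ℕ}
    (h : (fireAction R q (M q)).Fires c.marking m) :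
    ∃ c', m = c'.marking ∧ Step M q₀ n c c' := by
  obtain ⟨o, b, u, v⟩ := c
  obtain ⟨d, h1, h2⟩ := h
  cases hq : M q with
  | inc s a =>
    rw [hq] at h1 h2 hM
    have hs := h1 (.state (some q)) (by simp [fireAction])
    have hb := h1 .budget (by simp [fireAction])
    simp only [fireAction, marking, Config.marking, Pi.single_apply] at hs hb
    obtain rfl : o = some q := by
      by_contra h
      simp [Ne.symm h] at hs
    obtain ⟨b, rfl⟩ := Nat.exists_eq_add_of_le' hb
    refine ⟨_, ?_, .inc b u v hq⟩
    ext p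
    rw [h2 p]
    cases p with
    | state o => simp [fireAction, marking, Config.marking, Pi.single_apply]
    | ctr r =>
      by_cases hr : (r : ℕ) = s <;>
        simp [fireAction, marking, Config.marking, hr]
    | _ => simp [fireAction, marking, Config.marking]
  | dec s a b' =>
    rw [hq] at h1 h2 hM
    have hs := h1 (.state (some q)) (by simp [fireAction])
    have hb := h1 .budget (by simp [fireAction])
    have hr := h1 (.ctr ⟨s, hM⟩) (by simp [fireAction])
    simp only [fireAction, marking, Config.marking, Pi.single_apply, if_true] at hs hb hr
    obtain rfl : o = some q := by
      by_contra h
      simp [Ne.symm h] at hs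
    obtain ⟨b, rfl⟩ := Nat.exists_eq_add_of_le' hb
    refine ⟨_, ?_, .dec b u v hq (by lia)⟩
    ext p
    rw [h2 p]
    cases p with
    | state o => simp [fireAction, marking, Config.marking, Pi.single_apply]
    | ctr r =>
      by_cases hr : (r : ℕ) = s <;>
        simp [fireAction, marking, Config.marking, hr]
    | _ => simp [fireAction, marking, Config.marking]

theorem fires_zeroAction {q : Q} (hM : (M q).reg < R) {c : Config Q} {m : Place Q R → ℕ}
    (h : (zeroAction R q (M q)).Fires c.marking m) :
    ∃ c', m = c'.marking ∧ Step M q₀ n c c' := by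
  cases hq : M q with
  | inc s a => exact fires_fireAction hM (by rw [hq] at h ⊢; exact h)
  | dec s a b' =>
    obtain ⟨o, b, u, v⟩ := c
    obtain ⟨d, h1, h2⟩ := h
    rw [hq] at h1 h2 hM
    have hR : s < R := hM
    have hs := h1 (.state (some q)) (by simp [zeroAction, ctrPlace, hR])
    have hb := h1 .budget (by simp [zeroAction, ctrPlace, hR])
    simp only [zeroAction, marking, Config.marking, Pi.single_apply, if_true] at hs hb
    obtain rfl : o = some q := by
      by_contra h
      simp [Ne.symm h] at hs
    obtain ⟨b, rfl⟩ := Nat.exists_eq_add_of_le' hb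
    refine ⟨_, ?_, .zero b u v hq⟩
    ext p
    rw [h2 p]
    cases p with
    | state o => simp [zeroAction, ctrPlace, hR, marking, Config.marking, Pi.single_apply]
    | ctr r =>
      by_cases hr : (r : ℕ) = s
      · simp [zeroAction, ctrPlace, hR, marking, Config.marking, hr, Fin.ext_iff]
      · simp [zeroAction, ctrPlace, hR, marking, Config.marking, hr, Fin.ext_iff, Ne.symm hr]
    | _ => simp [zeroAction, ctrPlace, hR, marking, Config.marking]

/-- From the marking of a configuration, the net can only make steps of the budget machine. -/
theorem fires_ruleAction (hM : ∀ q, (M q).reg < R) {i : Rule Q} {c : Config Q}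
    {m : Place Q R → ℕ} (h : (ruleAction R M i).Fires c.marking m) :
    ∃ c', m = c'.marking ∧ Step M q₀ n c c' := by
  cases i with
  | launch =>
    obtain ⟨d, h1, h2⟩ := h
    -- The marking of a configuration has no token on `start`, so a second launch is impossible.
    have := h1 .start (by simp [ruleAction])
    simp [ruleAction, marking, Config.marking] at this
  | refund =>
    obtain ⟨o, b, u, v⟩ := c
    obtain ⟨d, h1, h2⟩ := h
    have hs := h1 (.state none) (by simp [ruleAction])
    have hb := h1 .used (by simp [ruleAction])
    simp only [ruleAction, marking, Config.marking, Pi.single_apply] at hs hb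
    obtain rfl : o = none := by
      by_contra h
      simp [Ne.symm h] at hs
    obtain ⟨u, rfl⟩ := Nat.exists_eq_add_of_le' hb
    refine ⟨_, ?_, .refund b u v⟩
    ext p
    rw [h2 p]
    cases p <;> simp [ruleAction, marking, Config.marking, Pi.single_apply]
  | fire q => exact fires_fireAction (hM q) h
  | zero q => exact fires_zeroAction (hM q) h

/-- The net can make all steps of the budget machine. -/
theorem Step.fires (hM : ∀ q, (M q).reg < R) {c c' : Config Q} (h : Step M q₀ n c c') :
    (restartAction R q₀ n).Fires c.marking c'.marking ∨
      ∃ i, (ruleAction R M i).Fires c.marking c'.marking := by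
  cases h with
  | @inc q s a b u v hq =>
    refine .inr ⟨.fire q, 0, fun p _ => ?_, fun p => ?_⟩
    · cases p <;> simp [ruleAction, hq, fireAction, marking, Config.marking]
    · cases p with
      | ctr r =>
        by_cases hr : (r : ℕ) = s <;>
          simp [ruleAction, hq, fireAction, marking, Config.marking, hr]
      | _ => simp [ruleAction, hq, fireAction, marking, Config.marking]
  | @dec q s a b' b u v hq h0 =>
    refine .inr ⟨.fire q, 0, fun p _ => ?_, fun p => ?_⟩
    · cases p with
      | ctr r =>
        by_cases hr : (r : ℕ) = s
        · simp [ruleAction, hq, fireAction, marking, Config.marking, hr, Nat.one_le_iff_ne_zero, h0]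
        · simp [ruleAction, hq, fireAction, marking, Config.marking, hr]
      | _ => simp [ruleAction, hq, fireAction, marking, Config.marking]
    · cases p with
      | ctr r =>
        by_cases hr : (r : ℕ) = s <;>
          simp [ruleAction, hq, fireAction, marking, Config.marking, hr]
      | _ => simp [ruleAction, hq, fireAction, marking, Config.marking]
  | @zero q s a b' b u v hq =>
    have hR : s < R := by simpa [hq, CounterInstr.reg] using hM q
    refine .inr ⟨.zero q, 0, fun p _ => ?_, fun p => ?_⟩
    · cases p <;> simp [ruleAction, hq, zeroAction, marking, Config.marking]
    · cases p with
      | ctr r =>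
        by_cases hr : (r : ℕ) = s
        · simp [ruleAction, hq, zeroAction, ctrPlace, hR, marking, Config.marking, hr, Fin.ext_iff]
        · simp [ruleAction, hq, zeroAction, ctrPlace, hR, marking, Config.marking, hr, Fin.ext_iff,
            Ne.symm hr]
      | _ => simp [ruleAction, hq, zeroAction, ctrPlace, hR, marking, Config.marking]
  | refund b u v =>
    refine .inr ⟨.refund, 0, fun p _ => ?_, fun p => ?_⟩ <;> cases p <;>
      simp [ruleAction, marking, Config.marking]
  | restart b u v =>
    refine .inl ⟨0, fun p hp => ?_, fun p => ?_⟩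
    · cases p <;> simp [restartAction, marking, Config.marking]
    · cases p with
      | ctr r =>
        by_cases hr : (r : ℕ) = 0 <;>
          simp [restartAction, marking, Config.marking, hr]
      | _ => simp [restartAction, marking, Config.marking]

theorem fires_launch (B : ℕ) :
    (ruleAction R M .launch).Fires initMarking (Config.marking ⟨none, B, 0, 0⟩) := by
  refine ⟨B, fun p _ => ?_, fun p => ?_⟩ <;> cases p <;>
    simp [ruleAction, initMarking, marking, Config.marking]

/-- Every action but the launch consumes a state token, and initially there is none. -/
theorem fires_initMarking {m : Place Q R → ℕ}
    (h : (restartAction R q₀ n).Fires initMarking m ∨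
      ∃ i, (ruleAction R M i).Fires initMarking m) :
    ∃ B, m = Config.marking ⟨none, B, 0, 0⟩ := by
  have hstate : ∀ (a : Action (Place Q R)) (o : Option Q), a.clear ≠ some (.state o) →
      a.pre (.state o) = 1 → ¬ a.Fires initMarking m := by
    rintro a o h1 h2 ⟨d, h3, -⟩
    have := h3 _ h1
    simp [h2, initMarking, marking] at this
  have hctr : ∀ (r : ℕ) (o : Option Q), ctrPlace Q R r ≠ some (.state o) := by
    intro r o
    rw [ctrPlace]
    split_ifs <;> simp
  rcases h with h | ⟨_ | _ | q | q, h⟩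
  · exact absurd h (hstate _ none (by simp [restartAction]) (by simp [restartAction, marking]))
  · obtain ⟨d, -, h⟩ := h
    refine ⟨d, ?_⟩
    ext p
    rw [h p]
    cases p <;> simp [ruleAction, initMarking, marking, Config.marking]
  · exact absurd h (hstate _ none (by simp [ruleAction]) (by simp [ruleAction, marking]))
  · refine absurd h (hstate _ (some q) ?_ ?_) <;> cases hq : M q <;>
      simp [ruleAction, fireAction, hq, marking]
  · refine absurd h (hstate _ (some q) ?_ ?_) <;> cases hq : M q <;>
      simp [ruleAction, zeroAction, fireAction, hq, marking, hctr]

/-- The net has an infinite execution iff the counter machine halts on `n`. -/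
theorem exists_infinite_iff (hR : 0 < R) (hM : ∀ q, (M q).reg < R)
    (hclear : ∀ v k w, CounterExec M (some q₀) v k w → ∀ r < R, w r = 0) :
    (∃ m : ℕ → Place Q R → ℕ, m 0 = initMarking ∧
      ∀ i, (restartAction R q₀ n).Fires (m i) (m (i + 1)) ∨
        ∃ j, (ruleAction R M j).Fires (m i) (m (i + 1))) ↔
    ∃ s w, CounterExec M (some q₀) (Pi.single 0 n) s w := by
  constructor
  · rintro ⟨m, h0, h1⟩
    -- The initial marking is not that of a configuration, so the run of the budget machine starts
    -- at index `1`.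
    obtain ⟨B, hB⟩ := fires_initMarking (h0 ▸ h1 0)
    have step : ∀ i (c : Config Q), m (i + 1) = c.marking →
        ∃ c', m (i + 1 + 1) = c'.marking ∧ Step M q₀ n c c' := by
      intro i c hc
      rcases h1 (i + 1) with h | ⟨j, h⟩ <;> rw [hc] at h
      · exact fires_restartAction h
      · exact fires_ruleAction hM h
    choose f hf hstep using step
    let c : (i : ℕ) → {c : Config Q // m (i + 1) = c.marking} := fun i =>
      Nat.rec ⟨⟨none, B, 0, 0⟩, hB⟩ (fun i c => ⟨f i c.1 c.2, hf i c.1 c.2⟩) i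
    exact exists_counterExec_of_infinite hR hM hclear (fun i => (c i).1) (fun _ _ => rfl)
      fun i => hstep i _ (c i).2
  · rintro ⟨s, w, h⟩
    obtain ⟨B, hB⟩ := exists_cycle hR hM hclear h
    set c₀ : Config Q := ⟨none, B, 0, 0⟩
    -- A configuration with a nonempty path to `c₀` has a successor of the same kind, because `c₀`
    -- lies on a cycle. Iteration gives an infinite run.
    have step : ∀ c : {c // TransGen (Step M q₀ n) c c₀},
        ∃ c' : {c // TransGen (Step M q₀ n) c c₀}, Step M q₀ n c.1 c'.1 := by
      rintro ⟨c, hc⟩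
      obtain ⟨c', h1, h2⟩ := TransGen.head'_iff.1 hc
      rcases reflTransGen_iff_eq_or_transGen.1 h2 with rfl | h2
      · exact ⟨⟨c₀, hB⟩, h1⟩
      · exact ⟨⟨c', h2⟩, h1⟩
    choose f hf using step
    refine ⟨fun i => i.casesOn initMarking fun i => (f^[i] ⟨c₀, hB⟩).1.marking, rfl, fun i => ?_⟩
    cases i with
    | zero => exact .inr ⟨.launch, fires_launch B⟩
    | succ i =>
      simp only [iterate_succ_apply']
      exact (hf _).fires hM

/-- The restart alone empties `used`, so the input labels differ there. -/
theorem toTransition_ruleAction_ne {k : ℕ} (T : Bool) (σ : Option (Place Q R) ≃ Fin k)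
    (i : Rule Q) :
    (ruleAction R M i).toTransition T σ ≠ (restartAction R q₀ n).toTransition T σ := by
  intro h
  have h1 := congrArg (fun t => t.input (σ (some .used))) h
  simp only [Action.toTransition_input] at h1
  have hctr : ∀ r : ℕ, ctrPlace Q R r ≠ some .used := by
    intro r
    rw [ctrPlace]
    split_ifs <;> simp
  have h2 : (ruleAction R M i).clear ≠ some .used := by
    rcases i with _ | _ | q | q
    · simp [ruleAction]
    · simp [ruleAction]
    · cases hq : M q <;> simp [ruleAction, fireAction, hq]
    · cases hq : M q <;> simp [ruleAction, zeroAction, fireAction, hq, hctr]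
  rw [Action.inLabel, if_neg h2, Action.inLabel,
    if_pos (show (restartAction R q₀ n).clear = some .used from rfl)] at h1
  cases T <;> simp at h1

theorem pump_ruleAction {i : Rule Q} (hi : i ≠ .launch) : (ruleAction R M i).pump = none := by
  rcases i with _ | _ | q | q
  · exact absurd rfl hi
  · rfl
  · cases hq : M q <;> simp [ruleAction, fireAction, hq]
  · cases hq : M q <;> simp [ruleAction, zeroAction, fireAction, hq]

end BudgetMachine

/-! ### Undecidability. -/

namespace OmegaNet

open Nat.Partrec

/-- There is a computable family of nets such that termination of its members is undecidable. -/
theorem exists_net_family (T : Bool) :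
    ∃ N : ℕ → Net, Computable (fun n => (N n).code) ∧
      (∀ n, (T = true → (N n).IsOmegaOPNT) ∧ (T = false → (N n).IsOmegaOPNR) ∧
        (N n).HasOneOmegaOutputArc) ∧
      ∀ n, (N n).Terminates ↔ ¬ (Code.eval (Denumerable.ofNat Code n) 0).Dom := by
  obtain ⟨Q, _, M, q₀, R, hR, hM, hclear, hdom⟩ := exists_counterExec_iff_dom
  let σ := Fintype.equivFin (Option (BudgetMachine.Place Q R))
  have hne := fun n => BudgetMachine.toTransition_ruleAction_ne (M := M) (q₀ := q₀) (n := n) T σ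
  refine ⟨fun n => actionNet T σ (BudgetMachine.restartAction R q₀ n)
    (BudgetMachine.ruleAction R M) BudgetMachine.initMarking (hne n), ?_, fun n => ⟨?_, ?_, ?_⟩,
    fun n => ?_⟩
  · refine computable_actionNet_code _ (some .used) none (fun _ => rfl) (fun _ => rfl)
      (fun p => ?_) (fun p => ?_) hne
    · cases p with
      | budget => exact Computable.id
      | _ => exact .const _
    · cases p with
      | ctr r =>
        simp only [BudgetMachine.restartAction, BudgetMachine.marking, Pi.single_apply]
        split_ifs
        · exact Computable.id
        · exact .const _
      | _ => exact .const _
  · exact actionNet_isOmegaOPNT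
  · exact actionNet_isOmegaOPNR
  · exact actionNet_hasOneOmegaOutputArc rfl .launch .budget rfl
      fun i hi => BudgetMachine.pump_ruleAction hi
  · rw [actionNet_terminates_iff, ← hdom n, BudgetMachine.exists_infinite_iff hR hM hclear]

theorem TerminationDecidableOn.mono {C C' : Net → Prop} (h : ∀ N, C N → C' N)
    (hC' : TerminationDecidableOn C') : TerminationDecidableOn C := by
  obtain ⟨f, hf, hf'⟩ := hC'
  exact ⟨f, hf, fun N hN => hf' N (h N hN)⟩

/-- A decision procedure on `C` halts on the codes of all `N n`; composed with the computable family
it would decide the complement of the halting problem. -/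
theorem not_terminationDecidableOn {C : Net → Prop} {N : ℕ → Net}
    (hcode : Computable fun n => (N n).code) (hC : ∀ n, C (N n))
    (hN : ∀ n, (N n).Terminates ↔ ¬ (Code.eval (Denumerable.ofNat Code n) 0).Dom) :
    ¬ TerminationDecidableOn C := by
  classical
  rintro ⟨f, hf, hf'⟩
  have h1 : Partrec fun c : Code => f (N (Encodable.encode c)).code :=
    hf.comp (hcode.comp Computable.encode)
  have h2 : Computable fun c : Code => decide (N (Encodable.encode c)).Terminates := by
    refine h1.of_eq_tot fun c => ?_
    by_cases h : (N (Encodable.encode c)).Terminates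
    · simpa [h] using (hf' _ (hC (Encodable.encode c))).1.2 h
    · simpa [h] using (hf' _ (hC (Encodable.encode c))).2.2 h
  have h3 : ComputablePred fun c : Code => (N (Encodable.encode c)).Terminates :=
    ⟨inferInstance, h2⟩
  refine ComputablePred.halting_problem 0 (h3.not.of_eq fun c => ?_)
  rw [hN, not_not, Denumerable.ofNat_encode]

end OmegaNet

/-- Termination is undecidable for ω-output Petri nets with transfer arcs and for ω-output Petri
nets with reset arcs, even when restricted to nets with exactly one ω-output arc. -/
theorem mainTheorem5 :
    (¬ OmegaNet.TerminationDecidableOn (fun N => N.IsOmegaOPNT) ∧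
      ¬ OmegaNet.TerminationDecidableOn (fun N => N.IsOmegaOPNT ∧ N.HasOneOmegaOutputArc)) ∧
    (¬ OmegaNet.TerminationDecidableOn (fun N => N.IsOmegaOPNR) ∧
      ¬ OmegaNet.TerminationDecidableOn (fun N => N.IsOmegaOPNR ∧ N.HasOneOmegaOutputArc)) := by
  obtain ⟨N, hcode, hC, hN⟩ := OmegaNet.exists_net_family true
  obtain ⟨N', hcode', hC', hN'⟩ := OmegaNet.exists_net_family false
  have hT := OmegaNet.not_terminationDecidableOn
    (C := fun N => N.IsOmegaOPNT ∧ N.HasOneOmegaOutputArc) hcode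
    (fun n => ⟨(hC n).1 rfl, (hC n).2.2⟩) hN
  have hR := OmegaNet.not_terminationDecidableOn
    (C := fun N => N.IsOmegaOPNR ∧ N.HasOneOmegaOutputArc) hcode'
    (fun n => ⟨(hC' n).2.1 rfl, (hC' n).2.2⟩) hN'
  exact ⟨⟨fun h => hT (h.mono fun _ => And.left), hT⟩, fun h => hR (h.mono fun _ => And.left), hR⟩
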